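/- **Setting.** Let $q_0,q_1,r_1,r_2,h,c>0$ and $0<\Theta_1<z\le\Theta_2$. The wind is a two-state Markov chain (state $0$: not blowing, state $1$: blowing, mean holding times $1/q_0$, $1/q_1$). Independently, the upper comfort limit $\Theta_M(t)\in\{\Theta_1,\Theta_2\}$ is a two-state Markov chain with mean holding times $1/r_1$, $1/r_2$. Write $ij\in\{00,01,10,11\}$ for the joint mode: $i$ is the wind state, and $j=0,1$ means $\Theta_M=\Theta_1,\Theta_2$. Let $Q=[Q_1,Q_2,Q_3,Q_4]$ be the generator of the joint chain in column convention: the columns correspond to the modes $00,01,10,11$ that are left, off-diagonal entries are transition rates, and every column sums to $0$. Under the $z$-policy the continuous temperature $x(t)$ of a load starts in $[0,z]$ (and hence stays there), the future of the environment depends on the past only through the current mode, and $$\dot x=\begin{cases}-c & \text{wind blowing},\ x>0,\\ 0 & \text{wind blowing},\ x=0,\\ h & \text{wind not blowing},\ x<\min(z,\Theta_M),\\ 0 & \text{wind not blowing},\ x=\min(z,\Theta_M),\\ -c & x>\Theta_M.\end{cases}$$ Let $D(x)=\mathrm{diag}(D_{11}(x),h,-c,-c)$ with $D_{11}(x)=h$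 for $x<\Theta_1$ and $D_{11}(x)=-c$ for $x>\Theta_1$. **Lemma.** Suppose that the process (temperature, mode) is stationary, i.e. its law at time $t$ does not depend on $t$. Then this law consists of nonnegative densities $p^z=(p_{00},p_{01},p_{10},p_{11})$ on $(0,\Theta_1)\cup(\Theta_1,z)$ and four nonnegative point masses: $\delta_{0,0}$ and $\delta_{0,1}$ at temperature $0$ in the modes $10$ and $11$ respectively, $\delta_{\Theta_1}$ at temperature $\Theta_1$ in mode $00$, and $\delta_z$ at temperature $z$ in mode $01$. The densities are differentiable on $(0,\Theta_1)\cup(\Theta_1,z)$ and integrable, the one-sided limits below exist, and $$D(x)\,\frac{d}{dx}p^z(x)=Q\,p^z(x)\qquad (x\in(0,\Theta_1)\cup(\Theta_1,z)),$$ $$Q_1\,\delta_{\Theta_1}=D(\Theta_1+)p^z(\Theta_1+)-D(\Theta_1-)p^z(\Theta_1-),$$ $$Q_2\,\delta_z=-D(z-)p^z(z-),$$ $$Q_3\,\delta_{0,0}+Q_4\,\delta_{0,1}=D(0+)p^z(0+),$$ $$\int_0^z \mathbf 1^Tp^z(x)\,dx+\delta_{0,0}+\delta_{0,1}+\delta_{\Theta_1}+\delta_z=1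 .$$ Moreover this linear system determines the distribution: any real (not necessarily nonnegative) solution of it, consisting of four functions on $(0,\Theta_1)\cup(\Theta_1,z)$ that are differentiable and integrable and have the one-sided limits above, and of four numbers, coincides with $p^z$ and $(\delta_{0,0},\delta_{0,1},\delta_{\Theta_1},\delta_z)$. -/

import Mathlib

open MeasureTheory Set Filter Topology
open scoped NNReal Kronecker

noncomputable section

namespace ZPolicy

/-- A mode `(i, j)` of the environment: `i = 0, 1` means that the wind is not blowing, respectively
blowing; `j = 0, 1` means that the upper comfort limit is `Θ₁`, respectively `Θ₂`. -/
abbrev Mode := Fin 2 × Fin 2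

/-- The constants of the model. `q₀, q₁` are the reciprocals of the mean holding times of the wind
states "not blowing", "blowing"; `r₁, r₂` those of the comfort limits `Θ₁, Θ₂`; `h` is the heating
rate, `c` the maximal cooling rate and `z` the threshold assigned to the load. -/
structure Params where
  q₀ : ℝ
  q₁ : ℝ
  r₁ : ℝ
  r₂ : ℝ
  h : ℝ
  c : ℝ
  Θ₁ : ℝ
  Θ₂ : ℝ
  z : ℝ
  q₀_pos : 0 < q₀
  q₁_pos : 0 < q₁
  r₁_pos : 0 < r₁
  r₂_pos : 0 < r₂
  h_pos : 0 < h
  c_pos : 0 < c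
  Θ₁_pos : 0 < Θ₁
  Θ₁_lt_z : Θ₁ < z
  z_le_Θ₂ : z ≤ Θ₂

variable (m : Params)

/-- Generator of the two-state wind process, in column convention: the entry `(k, l)` is the rate of
the transition from `l` to `k`, and the columns sum to zero. -/
def windGen : Matrix (Fin 2) (Fin 2) ℝ :=
  !![-m.q₀, m.q₁; m.q₀, -m.q₁]

/-- Generator of the two-state comfort-limit process, in column convention. -/
def comfortGen : Matrix (Fin 2) (Fin 2) ℝ :=
  !![-m.r₁, m.r₂; m.r₁, -m.r₂]

/-- Generator `Q` (column convention) of the pair (wind, comfort limit) formed of two independent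
chains. -/
def Q : Matrix Mode Mode ℝ :=
  windGen m ⊗ₖ (1 : Matrix (Fin 2) (Fin 2) ℝ) + (1 : Matrix (Fin 2) (Fin 2) ℝ) ⊗ₖ comfortGen m

/-- The upper comfort limit in force. -/
def limit (j : Fin 2) : ℝ := if j = 0 then m.Θ₁ else m.Θ₂

/-- Rate of change of the temperature under the `z`-policy. Blowing wind cools at rate `c`, except
at the lower limit `0`, where the temperature is kept. Without wind the load heats at rate `h`
below `min z Θ_M`, keeps the temperature `min z Θ_M`, and cools at rate `c` above `Θ_M`. (The
process below starts in `[0, z]`, hence never visits `x < 0` or `z < x`.) -/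
def velocity (x : ℝ) (k : Mode) : ℝ :=
  if k.1 = 1 then (if 0 < x then -m.c else 0)
  else if x < min m.z (limit m k.2) then m.h
  else if limit m k.2 < x then -m.c
  else 0

/-- The process (temperature, mode) of one load under the `z`-policy, on a filtered probability
space. `J` is a piecewise constant right-continuous Markov chain with generator `Q`, Markov with
respect to the filtration, and the temperature `X` solves the dynamics of the policy along `J`. -/
structure IsProcess {Ω : Type*} [MeasurableSpace Ω] (P : Measure Ω)
    (ℱ : Filtration ℝ≥0 (inferInstance : MeasurableSpace Ω))
    (X : ℝ≥0 → Ω → ℝ) (J : ℝ≥0 → Ω → Mode) : Prop where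
  measurable_temp : ∀ t, Measurable[ℱ t] (X t)
  measurable_mode : ∀ t, Measurable[ℱ t] (J t)
  mode_right : ∀ ω t, ∀ᶠ s in 𝓝[>] t, J s ω = J t ω
  mode_left : ∀ ω t, ∃ k, ∀ᶠ s in 𝓝[<] t, J s ω = k
  markov : ∀ (t s : ℝ≥0) (k : Mode),
    P[{ω | J (t + s) ω = k}.indicator (fun _ => (1 : ℝ)) | ℱ t]
      =ᵐ[P] fun ω => NormedSpace.exp ((s : ℝ) • Q m) k (J t ω)
  init : ∀ ω, X 0 ω ∈ Icc 0 m.z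
  continuous_temp : ∀ ω, Continuous fun t => X t ω
  dynamics : ∀ ω (t : ℝ≥0),
    HasDerivWithinAt (fun s : ℝ => X s.toNNReal ω) (velocity m (X t ω) (J t ω)) (Ioi (t : ℝ)) t

/-- The one-time marginal laws of (temperature, mode) do not depend on time. -/
def IsStationary {Ω : Type*} [MeasurableSpace Ω] (P : Measure Ω)
    (X : ℝ≥0 → Ω → ℝ) (J : ℝ≥0 → Ω → Mode) : Prop :=
  ∀ t, P.map (fun ω => (X t ω, J t ω)) = P.map (fun ω => (X 0 ω, J 0 ω))

/-- The diagonal matrix `D(x)` of the rates `dx/dt` in the modes `00, 01, 10, 11`, for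
`x ∈ (0, Θ₁) ∪ (Θ₁, z)`. -/
def D (x : ℝ) : Matrix Mode Mode ℝ :=
  Matrix.diagonal fun k =>
    if k = (0, 0) then (if x < m.Θ₁ then m.h else -m.c)
    else if k = (0, 1) then m.h
    else -m.c

/-- The four point masses: at temperature `0` in the modes `(1, 0)` and `(1, 1)`, at `Θ₁` in the
mode `(0, 0)`, and at `z` in the mode `(0, 1)`. -/
structure Masses where
  zero₀ : ℝ
  zero₁ : ℝ
  atΘ₁ : ℝ
  atz : ℝ

/-- The set on which the densities live. -/
def domain : Set ℝ := Ioo 0 m.Θ₁ ∪ Ioo m.Θ₁ m.z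

/-- The linear system for the densities `p = (p₀₀, p₀₁, p₁₀, p₁₁)` and the point masses `δ`. The
one-sided values of the flux `D p` are genuine limits. -/
structure IsSolution (p : ℝ → Mode → ℝ) (δ : Masses) : Prop where
  ode : ∀ x ∈ domain m, ∃ p' : Mode → ℝ,
    HasDerivAt p p' x ∧ (D m x).mulVec p' = (Q m).mulVec (p x)
  at_Θ₁ : ∃ a b : Mode → ℝ,
    Tendsto (fun x => (D m x).mulVec (p x)) (𝓝[<] m.Θ₁) (𝓝 a) ∧
    Tendsto (fun x => (D m x).mulVec (p x)) (𝓝[>] m.Θ₁) (𝓝 b) ∧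
    δ.atΘ₁ • (Q m).col (0, 0) = b - a
  at_z : ∃ a : Mode → ℝ,
    Tendsto (fun x => (D m x).mulVec (p x)) (𝓝[<] m.z) (𝓝 a) ∧
    δ.atz • (Q m).col (0, 1) = -a
  at_zero : ∃ b : Mode → ℝ,
    Tendsto (fun x => (D m x).mulVec (p x)) (𝓝[>] 0) (𝓝 b) ∧
    δ.zero₀ • (Q m).col (1, 0) + δ.zero₁ • (Q m).col (1, 1) = b
  integrable : ∀ k, IntervalIntegrable (fun x => p x k) volume 0 m.z
  normalization :
    (∫ x in (0)..m.z, ∑ k, p x k) + δ.zero₀ + δ.zero₁ + δ.atΘ₁ + δ.atz = 1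

/-- The measure on `ℝ × Mode` with densities `p k` on `(0, z) × {k}` and point masses `δ`. -/
def law (p : ℝ → Mode → ℝ) (δ : Masses) : Measure (ℝ × Mode) :=
  (∑ k : Mode,
    ((volume.restrict (Ioo 0 m.z)).withDensity fun x => ENNReal.ofReal (p x k)).map
      fun x => (x, k))
  + ENNReal.ofReal δ.zero₀ • Measure.dirac (0, (1, 0))
  + ENNReal.ofReal δ.zero₁ • Measure.dirac (0, (1, 1))
  + ENNReal.ofReal δ.atΘ₁ • Measure.dirac (m.Θ₁, (0, 0))
  + ENNReal.ofReal δ.atz • Measure.dirac (m.z, (0, 1))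

/-- `D(x)` indeed lists the rates of change of the temperature. -/
theorem D_eq_velocity {x : ℝ} (hx : x ∈ domain m) : D m x = Matrix.diagonal (velocity m x) := by
  have h1 := m.Θ₁_pos
  have h2 := m.Θ₁_lt_z
  have h3 := m.z_le_Θ₂
  unfold D
  congr 1
  funext k
  obtain ⟨i, j⟩ := k
  rcases hx with ⟨h4, h5⟩ | ⟨h4, h5⟩
  · have h6 : x < m.z := h5.trans h2
    have h7 : x < m.Θ₂ := h6.trans_le h3
    fin_cases i <;> fin_cases j <;> simp [velocity, limit, h4, h5, h6, h7]
  · have h6 : 0 < x := h1.trans h4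
    have h7 : x < m.Θ₂ := h5.trans_le h3
    fin_cases i <;> fin_cases j <;> simp [velocity, limit, h4, h5, h6, h7, not_lt.2 h4.le]

/-- The columns of `Q` sum to zero. -/
theorem sum_Q_col (l : Mode) : ∑ k, Q m k l = 0 := by
  obtain ⟨i, j⟩ := l
  fin_cases i <;> fin_cases j <;>
    simp [Q, windGen, comfortGen, Fintype.sum_prod_type, Matrix.one_apply]

end ZPolicy

end

/-!
The proof has two independent halves: the stationary law solves the linear system, and the linear
system has at most one solution.

**The stationary law.** Let `μ k` be the law of the temperature on the event that the mode is `k`.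
For a smooth function `g` of the temperature, the expectation of `g (X s)` on the event `J s = k`
does not depend on `s`. Its derivative at `s = 0` is computed by splitting off the increment
`g (X s) - g (X 0)`, which is controlled because the temperature is Lipschitz in time, from
`g (X 0)` on `J s = k`, which the Markov property evaluates. The result is the stationarity equation
`∫ v_k g' dμ_k + ∑ l, Q k l ∫ g dμ_l = 0` (`IsProcess.integral_velocity_mul_deriv`). If `g` is a
primitive of a test function, Fubini's theorem turns this into
`v_k(y) μ_k(dy) = N_k(y) dy` with `N_k(y) = ∑ l, Q k l μ_l(-∞, y]`
(`IsInvariant.integral_mul_velocity`). Hence `μ_k` has the density `N_k / v_k` where `v_k ≠ 0`, and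
its only atoms are the zeros of `v_k`: `0` for blowing wind, `Θ₁` in mode `00` and `z` in
mode `01`. So the flux `D p` is `N`, a combination of distribution functions. Differentiating it gives
the differential equation, its jumps are the boundary conditions at `0` and `Θ₁`, and the one at `z`
follows from `N(z) = 0`, the stationarity equation for `g = 1`.

**Uniqueness.** For any solution of the homogeneous system the function
`F = ∑ k, sign(v_k) |flux_k| = ∑ k, v_k |p_k|` decreases on both intervals, since the columns of `Q`
sum to zero and its off-diagonal entries are nonnegative (`antitoneOn_abs_flux`); for the same
reason it does not increase across `Θ₁`, and `F(z-) = 0`. If the point mass at temperature `0` in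
mode `10` vanishes, then `F(0+) = -2 r₂ |δ|`, where `δ` is the mass in mode `11`. So `δ = 0`, and
Gronwall's inequality gives `p = 0` on `(0, Θ₁)`; then `F(Θ₁+) = -2 q₀ |δ'|` with the mass `δ'` at
`Θ₁`, and in the same way everything vanishes
(`IsFluxSolution.eq_zero_of_zero₀_eq_zero`). Thus the solutions of the homogeneous system form a
space of dimension at most one, and the normalization singles out one of them
(`IsSolution.unique`).
-/

namespace ZPolicy

/-! ### One-sided monotonicity and Gronwall arguments -/

theorem antitoneOn_Ioo_of_deriv_right_nonpos {F : ℝ → ℝ} {a b : ℝ}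
    (hF : ContinuousOn F (Ioo a b))
    (hF' : ∀ x ∈ Ioo a b, ∃ r ≤ 0, HasDerivWithinAt F r (Ici x) x) : AntitoneOn F (Ioo a b) := by
  intro x hx y hy hxy
  have hsub : Icc x y ⊆ Ioo a b := fun u hu => ⟨hx.1.trans_le hu.1, hu.2.trans_lt hy.2⟩
  choose! r hr0 hr using hF'
  exact image_le_of_deriv_right_le_deriv_boundary (f := F) (f' := r) (B := fun _ => F x)
    (B' := fun _ => 0) (hF.mono hsub) (fun u hu => hr u (hsub ⟨hu.1, hu.2.le⟩)) le_rfl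
    continuousOn_const (fun u _ => hasDerivWithinAt_const _ _ _)
    (fun u hu => hr0 u (hsub ⟨hu.1, hu.2.le⟩)) ⟨hxy, le_rfl⟩

theorem AntitoneOn.right_limit_le_left_limit {F : ℝ → ℝ} {a b A B : ℝ} (hab : a < b)
    (hF : AntitoneOn F (Ioo a b)) (hA : Tendsto F (𝓝[>] a) (𝓝 A))
    (hB : Tendsto F (𝓝[<] b) (𝓝 B)) : B ≤ A := by
  obtain ⟨u, hu⟩ := exists_between hab
  have h1 : F u ≤ A := by
    refine ge_of_tendsto hA ?_
    filter_upwards [Ioo_mem_nhdsGT hu.1] with x hx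
    exact hF ⟨hx.1, hx.2.trans hu.2⟩ hu hx.2.le
  have h2 : B ≤ F u := by
    refine le_of_tendsto hB ?_
    filter_upwards [Ioo_mem_nhdsLT hu.2] with x hx
    exact hF hu ⟨hu.1.trans hx.1, hx.2⟩ hx.1.le
  exact h2.trans h1

theorem hasDerivWithinAt_abs_of_eq_zero {w : ℝ → ℝ} {w' x : ℝ} (hw : HasDerivAt w w' x)
    (h0 : w x = 0) : HasDerivWithinAt (fun y => |w y|) |w'| (Ici x) x := by
  rw [← hasDerivWithinAt_Ioi_iff_Ici, hasDerivWithinAt_iff_tendsto_slope' (by simp)]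
  have h1 : Tendsto (slope w x) (𝓝[>] x) (𝓝 w') :=
    (hasDerivWithinAt_iff_tendsto_slope' (by simp)).1 (hw.hasDerivWithinAt (s := Ioi x))
  refine h1.abs.congr' ?_
  filter_upwards [self_mem_nhdsWithin] with y hy
  have hy' : 0 < y - x := sub_pos.2 hy
  simp [slope_def_field, h0, abs_div, abs_of_pos hy']

/-- A Kato-type inequality: if `s w' = a w + b` at `x`, then the right derivative `r` of `|w|` at
`x` satisfies `s r ≤ a |w| + B` for every bound `B` of `|b|`. -/
theorem exists_deriv_right_abs_le {w : ℝ → ℝ} {w' x s a b B : ℝ} (hw : HasDerivAt w w' x)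
    (he : s * w' = a * w x + b) (hb : |b| ≤ B) :
    ∃ r, HasDerivWithinAt (fun y => |w y|) r (Ici x) x ∧ s * r ≤ a * |w x| + B := by
  rcases lt_trichotomy (w x) 0 with h | h | h
  · refine ⟨-w', ((hasDerivAt_abs_neg h).comp x hw).hasDerivWithinAt.congr_deriv (by ring), ?_⟩
    rw [abs_of_neg h]
    nlinarith [neg_abs_le b]
  · refine ⟨|w'|, hasDerivWithinAt_abs_of_eq_zero hw h, ?_⟩
    have h1 : s * |w'| ≤ |s * w'| := by
      rw [abs_mul]; exact mul_le_mul_of_nonneg_right (le_abs_self s) (abs_nonneg _)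
    rw [he, h] at h1
    rw [h]
    simpa using h1.trans (by simpa using hb)
  · refine ⟨w', ((hasDerivAt_abs_pos h).comp x hw).hasDerivWithinAt.congr_deriv (by ring), ?_⟩
    rw [abs_of_pos h, he]
    linarith [le_abs_self b]

variable (m : Params)

theorem Q_nonneg_of_ne {k l : Mode} (h : l ≠ k) : 0 ≤ Q m k l := by
  have h1 := m.q₀_pos.le
  have h2 := m.q₁_pos.le
  have h3 := m.r₁_pos.le
  have h4 := m.r₂_pos.le
  obtain ⟨i, j⟩ := k
  obtain ⟨i', j'⟩ := l
  fin_cases i <;> fin_cases j <;> fin_cases i' <;> fin_cases j' <;>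
    first
    | exact absurd rfl h
    | simp [Q, windGen, comfortGen, *]

/-- The signed `L¹`-flux of a solution of `s w' = Q w` decreases, because the columns of `Q` sum to
zero and its off-diagonal entries are nonnegative. -/
theorem antitoneOn_abs_flux {a b : ℝ} {s : Mode → ℝ} {w w' : ℝ → Mode → ℝ}
    (hw : ∀ x ∈ Ioo a b, HasDerivAt w (w' x) x)
    (he : ∀ x ∈ Ioo a b, ∀ k, s k * w' x k = (Q m).mulVec (w x) k) :
    AntitoneOn (fun x => ∑ k, s k * |w x k|) (Ioo a b) := by
  have hwk : ∀ x ∈ Ioo a b, ∀ k, HasDerivAt (fun y => w y k) (w' x k) x := fun x hx k =>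
    hasDerivAt_pi.1 (hw x hx) k
  apply antitoneOn_Ioo_of_deriv_right_nonpos
  · intro x hx
    have h : ContinuousAt w x := (hw x hx).continuousAt
    have h' : ∀ k, ContinuousAt (fun y => w y k) x := fun k => (hwk x hx k).continuousAt
    exact (tendsto_finsetSum _ fun k _ => (h' k).abs.const_mul (s k)).mono_left
      nhdsWithin_le_nhds
  · intro x hx
    have key : ∀ k, ∃ r, HasDerivWithinAt (fun y => |w y k|) r (Ici x) x ∧
        s k * r ≤ ∑ l, Q m k l * |w x l| := by
      intro k
      have h1 : s k * w' x k = Q m k k * w x k + ∑ l ∈ Finset.univ.erase k, Q m k l * w x l := by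
        rw [he x hx k, Finset.add_sum_erase _ (fun l => Q m k l * w x l) (Finset.mem_univ k)]
        rfl
      have h2 : |∑ l ∈ Finset.univ.erase k, Q m k l * w x l| ≤
          ∑ l ∈ Finset.univ.erase k, Q m k l * |w x l| := by
        refine (Finset.abs_sum_le_sum_abs _ _).trans (Finset.sum_le_sum fun l hl => ?_)
        rw [abs_mul, abs_of_nonneg (Q_nonneg_of_ne m (Finset.ne_of_mem_erase hl))]
      obtain ⟨r, hr, hr'⟩ := exists_deriv_right_abs_le (hwk x hx k) h1 h2
      refine ⟨r, hr, hr'.trans_eq ?_⟩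
      rw [Finset.add_sum_erase _ (fun l => Q m k l * |w x l|) (Finset.mem_univ k)]
    choose r hr hr' using key
    refine ⟨∑ k, s k * r k, ?_, HasDerivWithinAt.fun_sum fun k _ => (hr k).const_mul (s k)⟩
    calc ∑ k, s k * r k ≤ ∑ k, ∑ l, Q m k l * |w x l| := Finset.sum_le_sum fun k _ => hr' k
      _ = ∑ l, (∑ k, Q m k l) * |w x l| := by
        rw [Finset.sum_comm]; simp_rw [Finset.sum_mul]
      _ = 0 := by simp [sum_Q_col]

theorem eqOn_zero_of_flux_tendsto_zero {a b : ℝ} {s : Mode → ℝ} (hs : ∀ k, s k ≠ 0)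
    {w w' : ℝ → Mode → ℝ} (hw : ∀ x ∈ Ioo a b, HasDerivAt w (w' x) x)
    (he : ∀ x ∈ Ioo a b, ∀ k, s k * w' x k = (Q m).mulVec (w x) k)
    (h0 : ∀ k, Tendsto (fun x => s k * w x k) (𝓝[>] a) (𝓝 0)) :
    ∀ x ∈ Ioo a b, w x = 0 := by
  intro x hx
  have h0' : Tendsto w (𝓝[>] a) (𝓝 0) := by
    refine tendsto_pi_nhds.2 fun k => ?_
    have := (h0 k).const_mul (s k)⁻¹
    simpa [inv_mul_cancel_left₀ (hs k)] using this
  set A : (Mode → ℝ) →L[ℝ] (Mode → ℝ) :=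
    (Matrix.toLin' (Matrix.diagonal (fun k => (s k)⁻¹) * Q m)).toContinuousLinearMap with hA
  have hA' : ∀ y ∈ Ioo a b, w' y = A (w y) := by
    intro y hy
    funext k
    have := he y hy k
    simp only [hA, LinearMap.coe_toContinuousLinearMap', Matrix.toLin'_apply,
      ← Matrix.mulVec_mulVec, Matrix.mulVec_diagonal]
    rw [← this, inv_mul_cancel_left₀ (hs k)]
  have hle : ∀ u ∈ Ioo a x, ‖w x‖ ≤ ‖w u‖ * Real.exp (‖A‖ * (x - a)) := by
    intro u hu
    have hsub : Icc u x ⊆ Ioo a b := fun y hy => ⟨hu.1.trans_le hy.1, hy.2.trans_lt hx.2⟩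
    have := norm_le_gronwallBound_of_norm_deriv_right_le (f := w) (f' := w') (δ := ‖w u‖)
      (K := ‖A‖) (ε := 0) (a := u) (b := x)
      (fun y hy => (hw y (hsub hy)).continuousAt.continuousWithinAt)
      (fun y hy => (hw y (hsub ⟨hy.1, hy.2.le⟩)).hasDerivWithinAt) le_rfl
      (fun y hy => by
        rw [hA' y (hsub ⟨hy.1, hy.2.le⟩), add_zero]; exact A.le_opNorm _) x ⟨hu.2.le, le_rfl⟩
    rw [gronwallBound_ε0] at this
    refine this.trans ?_
    gcongr
    exact hu.1.le
  have hlim : Tendsto (fun u => ‖w u‖ * Real.exp (‖A‖ * (x - a))) (𝓝[>] a) (𝓝 0) := by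
    simpa using h0'.norm.mul_const (Real.exp (‖A‖ * (x - a)))
  have : ‖w x‖ ≤ 0 := by
    refine ge_of_tendsto hlim ?_
    filter_upwards [Ioo_mem_nhdsGT hx.1] with u hu using hle u hu
  exact norm_le_zero_iff.1 this

/-! ### Uniqueness of the solution of the linear system -/

/-- The homogeneous part of the linear system: `IsSolution` without integrability and
normalization. -/
structure IsFluxSolution (p : ℝ → Mode → ℝ) (δ : Masses) : Prop where
  ode : ∀ x ∈ domain m, ∃ p' : Mode → ℝ,
    HasDerivAt p p' x ∧ (D m x).mulVec p' = (Q m).mulVec (p x)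
  at_Θ₁ : ∃ a b : Mode → ℝ,
    Tendsto (fun x => (D m x).mulVec (p x)) (𝓝[<] m.Θ₁) (𝓝 a) ∧
    Tendsto (fun x => (D m x).mulVec (p x)) (𝓝[>] m.Θ₁) (𝓝 b) ∧
    δ.atΘ₁ • (Q m).col (0, 0) = b - a
  at_z : ∃ a : Mode → ℝ,
    Tendsto (fun x => (D m x).mulVec (p x)) (𝓝[<] m.z) (𝓝 a) ∧
    δ.atz • (Q m).col (0, 1) = -a
  at_zero : ∃ b : Mode → ℝ,
    Tendsto (fun x => (D m x).mulVec (p x)) (𝓝[>] 0) (𝓝 b) ∧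
    δ.zero₀ • (Q m).col (1, 0) + δ.zero₁ • (Q m).col (1, 1) = b

variable {m} {p q : ℝ → Mode → ℝ} {δ ε : Masses}

theorem IsSolution.isFluxSolution (h : IsSolution m p δ) : IsFluxSolution m p δ :=
  ⟨h.ode, h.at_Θ₁, h.at_z, h.at_zero⟩

theorem IsFluxSolution.linear_comb (hp : IsFluxSolution m p δ) (hq : IsFluxSolution m q ε)
    (α β : ℝ) : IsFluxSolution m (fun x => α • p x + β • q x)
      ⟨α * δ.zero₀ + β * ε.zero₀, α * δ.zero₁ + β * ε.zero₁, α * δ.atΘ₁ + β * ε.atΘ₁,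
        α * δ.atz + β * ε.atz⟩ := by
  have hD : ∀ x, (D m x).mulVec (α • p x + β • q x) =
      α • (D m x).mulVec (p x) + β • (D m x).mulVec (q x) := fun x => by
    rw [Matrix.mulVec_add, Matrix.mulVec_smul, Matrix.mulVec_smul]
  refine ⟨fun x hx => ?_, ?_, ?_, ?_⟩
  · obtain ⟨p', hp', hpe⟩ := hp.ode x hx
    obtain ⟨q', hq', hqe⟩ := hq.ode x hx
    refine ⟨α • p' + β • q', (hp'.const_smul α).add (hq'.const_smul β), ?_⟩
    simp only [Matrix.mulVec_add, Matrix.mulVec_smul, hpe, hqe]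
  · obtain ⟨a, b, ha, hb, e⟩ := hp.at_Θ₁
    obtain ⟨a', b', ha', hb', e'⟩ := hq.at_Θ₁
    simp only [hD]
    refine ⟨_, _, (ha.const_smul α).add (ha'.const_smul β), (hb.const_smul α).add
      (hb'.const_smul β), ?_⟩
    rw [add_smul, mul_smul, mul_smul, e, e']
    module
  · obtain ⟨a, ha, e⟩ := hp.at_z
    obtain ⟨a', ha', e'⟩ := hq.at_z
    simp only [hD]
    refine ⟨_, (ha.const_smul α).add (ha'.const_smul β), ?_⟩
    rw [add_smul, mul_smul, mul_smul, e, e']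
    module
  · obtain ⟨a, ha, e⟩ := hp.at_zero
    obtain ⟨a', ha', e'⟩ := hq.at_zero
    simp only [hD]
    refine ⟨_, (ha.const_smul α).add (ha'.const_smul β), ?_⟩
    rw [← e, ← e']
    module

theorem D_mulVec_apply (x : ℝ) (v : Mode → ℝ) (k : Mode) :
    (D m x).mulVec v k = D m x k k * v k := by
  simp [D, Matrix.mulVec_diagonal]

theorem D_left {x y : ℝ} (hx : x < m.Θ₁) (hy : y < m.Θ₁) : D m x = D m y := by
  simp [D, hx, hy]

theorem D_right {x y : ℝ} (hx : m.Θ₁ < x) (hy : m.Θ₁ < y) : D m x = D m y := by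
  simp [D, not_lt.2 hx.le, not_lt.2 hy.le]

theorem D_ne_zero (x : ℝ) (k : Mode) : D m x k k ≠ 0 := by
  have h1 := m.h_pos.ne'
  have h2 := m.c_pos.ne'
  simp only [D, Matrix.diagonal_apply_eq]
  split_ifs <;> simp [h1, h2]

/-- The signed sum of the absolute fluxes; the sign is that of the velocity. -/
theorem sum_D_mul_abs (x : ℝ) (v : Mode → ℝ) :
    ∑ k, D m x k k * |v k| = (if x < m.Θ₁ then 1 else -1) * |(D m x).mulVec v (0, 0)| +
      |(D m x).mulVec v (0, 1)| - |(D m x).mulVec v (1, 0)| - |(D m x).mulVec v (1, 1)| := by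
  have h1 := m.h_pos
  have h2 := m.c_pos
  simp only [D_mulVec_apply, abs_mul, Fintype.sum_prod_type, Fin.sum_univ_two]
  by_cases hx : x < m.Θ₁ <;> simp [D, hx, abs_of_pos h1, abs_of_pos h2] <;> ring

/-- A solution of the homogeneous system is determined by its point mass at temperature `0` in mode
`10`. -/
theorem IsFluxSolution.eq_zero_of_zero₀_eq_zero (hp : IsFluxSolution m p δ)
    (h0 : δ.zero₀ = 0) : (∀ x ∈ domain m, p x = 0) ∧ δ = ⟨0, 0, 0, 0⟩ := by
  have hq0 := m.q₀_pos
  have hr2 := m.r₂_pos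
  have hΘ := m.Θ₁_pos
  have hz := m.Θ₁_lt_z
  obtain ⟨a, b, ha, hb, hab⟩ := hp.at_Θ₁
  obtain ⟨e, he, hez⟩ := hp.at_z
  obtain ⟨f, hf, hf0⟩ := hp.at_zero
  obtain ⟨d0, d1, dΘ, dz⟩ := δ
  simp only at h0 hab hez hf0
  subst h0
  choose! p' hp' hpe using hp.ode
  obtain ⟨x₁, hx₁⟩ := exists_between hΘ
  obtain ⟨x₂, hx₂⟩ := exists_between hz
  have hpe₁ : ∀ x ∈ Ioo 0 m.Θ₁, ∀ k, D m x₁ k k * p' x k = (Q m).mulVec (p x) k := by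
    intro x hx k
    rw [← hpe x (Or.inl hx), D_mulVec_apply, D_left hx.2 hx₁.2]
  have hpe₂ : ∀ x ∈ Ioo m.Θ₁ m.z, ∀ k, D m x₂ k k * p' x k = (Q m).mulVec (p x) k := by
    intro x hx k
    rw [← hpe x (Or.inr hx), D_mulVec_apply, D_right hx.1 hx₂.1]
  have anti₁ := antitoneOn_abs_flux m (fun x hx => hp' x (Or.inl hx)) hpe₁
  have anti₂ := antitoneOn_abs_flux m (fun x hx => hp' x (Or.inr hx)) hpe₂
  -- the one-sided limits of the signed sum of the absolute fluxes
  have lim₁ : ∀ {l : Filter ℝ} {v : Mode → ℝ}, (∀ᶠ x in l, x < m.Θ₁) →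
      Tendsto (fun x => (D m x).mulVec (p x)) l (𝓝 v) →
      Tendsto (fun x => ∑ k, D m x₁ k k * |p x k|) l
        (𝓝 (|v (0, 0)| + |v (0, 1)| - |v (1, 0)| - |v (1, 1)|)) := by
    intro l v hl hv
    have hv' := tendsto_pi_nhds.1 hv
    refine ((((hv' (0, 0)).abs.add (hv' (0, 1)).abs).sub (hv' (1, 0)).abs).sub
      (hv' (1, 1)).abs).congr' ?_
    filter_upwards [hl] with x hx
    rw [D_left hx₁.2 hx, sum_D_mul_abs, if_pos hx, one_mul]
  have lim₂ : ∀ {l : Filter ℝ} {v : Mode → ℝ}, (∀ᶠ x in l, m.Θ₁ < x) →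
      Tendsto (fun x => (D m x).mulVec (p x)) l (𝓝 v) →
      Tendsto (fun x => ∑ k, D m x₂ k k * |p x k|) l
        (𝓝 (-|v (0, 0)| + |v (0, 1)| - |v (1, 0)| - |v (1, 1)|)) := by
    intro l v hl hv
    have hv' := tendsto_pi_nhds.1 hv
    refine ((((hv' (0, 0)).abs.neg.add (hv' (0, 1)).abs).sub (hv' (1, 0)).abs).sub
      (hv' (1, 1)).abs).congr' ?_
    filter_upwards [hl] with x hx
    rw [D_right hx₂.1 hx, sum_D_mul_abs, if_neg (not_lt.2 hx.le), neg_one_mul]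
  have le₁ := AntitoneOn.right_limit_le_left_limit hΘ anti₁
    (lim₁ (eventually_nhdsWithin_of_eventually_nhds (Iio_mem_nhds hΘ)) hf)
    (lim₁ self_mem_nhdsWithin ha)
  have le₂ := AntitoneOn.right_limit_le_left_limit hz anti₂ (lim₂ self_mem_nhdsWithin hb)
    (lim₂ (eventually_nhdsWithin_of_eventually_nhds (Ioi_mem_nhds hz)) he)
  -- the boundary conditions in coordinates
  have hb' : b = dΘ • (Q m).col (0, 0) + a := by rw [hab]; abel
  have he' : e = -(dz • (Q m).col (0, 1)) := by rw [hez]; abel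
  subst hb' he'
  rw [← hf0] at le₁ hf
  have r1 := m.r₁_pos
  have q1 := m.q₁_pos
  have l0 : ∀ v : Mode → ℝ, v = (0 : ℝ) • (Q m).col (1, 0) + d1 • (Q m).col (1, 1) →
      |v (0, 0)| + |v (0, 1)| - |v (1, 0)| - |v (1, 1)| = -2 * m.r₂ * |d1| := by
    rintro v rfl
    have e1 : -m.q₁ + -m.r₂ = -(m.q₁ + m.r₂) := by ring
    simp [Q, windGen, comfortGen, abs_mul, e1, abs_of_pos q1, abs_of_pos hr2,
      abs_of_pos (add_pos q1 hr2), -neg_add_rev]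
    ring
  have lz : ∀ v : Mode → ℝ, v = -(dz • (Q m).col (0, 1)) →
      -|v (0, 0)| + |v (0, 1)| - |v (1, 0)| - |v (1, 1)| = 0 := by
    rintro v rfl
    have e1 : -m.q₀ + -m.r₂ = -(m.q₀ + m.r₂) := by ring
    simp [Q, windGen, comfortGen, abs_mul, e1, abs_of_pos hq0, abs_of_pos hr2,
      abs_of_pos (add_pos hq0 hr2), -neg_add_rev]
    ring
  have lΘ : ∀ v : Mode → ℝ, v = dΘ • (Q m).col (0, 0) →
      -|v (0, 0)| + |v (0, 1)| - |v (1, 0)| - |v (1, 1)| = -2 * m.q₀ * |dΘ| := by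
    rintro v rfl
    have e1 : -m.q₀ + -m.r₁ = -(m.q₀ + m.r₁) := by ring
    simp [Q, windGen, comfortGen, abs_mul, e1, abs_of_pos hq0, abs_of_pos r1,
      abs_of_pos (add_pos hq0 r1), -neg_add_rev]
    ring
  -- the functional does not increase across `Θ₁`
  have jump : ∀ v : Mode → ℝ, v = dΘ • (Q m).col (0, 0) →
      -|(v + a) (0, 0)| + |(v + a) (0, 1)| - |(v + a) (1, 0)| - |(v + a) (1, 1)| ≤
      |a (0, 0)| + |a (0, 1)| - |a (1, 0)| - |a (1, 1)| := by
    rintro v rfl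
    have e0 : dΘ * (-m.q₀ + -m.r₁) = -((m.q₀ + m.r₁) * dΘ) := by ring
    have n0 : |(m.q₀ + m.r₁) * dΘ| ≤ |-((m.q₀ + m.r₁) * dΘ) + a (0, 0)| + |a (0, 0)| := by
      have := abs_sub (a (0, 0)) (-((m.q₀ + m.r₁) * dΘ) + a (0, 0))
      rw [show a (0, 0) - (-((m.q₀ + m.r₁) * dΘ) + a (0, 0)) = (m.q₀ + m.r₁) * dΘ by ring] at this
      linarith
    have n1 : |dΘ * m.r₁ + a (0, 1)| ≤ |m.r₁ * dΘ| + |a (0, 1)| := by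
      rw [mul_comm dΘ]; exact abs_add_le _ _
    have n2 : |a (1, 0)| ≤ |dΘ * m.q₀ + a (1, 0)| + |m.q₀ * dΘ| := by
      have := abs_sub (dΘ * m.q₀ + a (1, 0)) (m.q₀ * dΘ)
      rwa [show dΘ * m.q₀ + a (1, 0) - m.q₀ * dΘ = a (1, 0) by ring] at this
    rw [abs_mul, abs_of_pos (add_pos hq0 r1)] at n0
    rw [abs_mul, abs_of_pos r1] at n1
    rw [abs_mul, abs_of_pos hq0] at n2
    simp [Q, windGen, comfortGen, e0, -neg_add_rev]
    linarith
  -- hence the functional is zero throughout, and the point masses vanish one after the other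
  rw [lz _ rfl] at le₂
  rw [l0 _ rfl] at le₁
  have hd1 : d1 = 0 := by
    have h1 := jump _ rfl
    have h2 : 0 ≤ -2 * m.r₂ * |d1| := by linarith
    have h3 : |d1| ≤ 0 := by nlinarith
    exact abs_nonpos_iff.1 h3
  subst hd1
  have left : ∀ x ∈ Ioo 0 m.Θ₁, p x = 0 := by
    refine eqOn_zero_of_flux_tendsto_zero m (D_ne_zero x₁) (fun x hx => hp' x (Or.inl hx)) hpe₁
      fun k => ?_
    have h1 := tendsto_pi_nhds.1 hf k
    simp only [zero_smul, add_zero, Pi.zero_apply] at h1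
    refine h1.congr' ?_
    filter_upwards [Ioo_mem_nhdsGT hΘ] with x hx
    rw [D_mulVec_apply, D_left hx.2 hx₁.2]
  have ha0 : a = 0 := by
    refine tendsto_nhds_unique ha (tendsto_const_nhds.congr' ?_)
    filter_upwards [Ioo_mem_nhdsLT hΘ] with x hx
    rw [left x hx, Matrix.mulVec_zero]
  subst ha0
  rw [add_zero] at le₂ hb
  rw [lΘ _ rfl] at le₂
  have hdΘ : dΘ = 0 := abs_nonpos_iff.1 (by nlinarith)
  subst hdΘ
  have right : ∀ x ∈ Ioo m.Θ₁ m.z, p x = 0 := by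
    refine eqOn_zero_of_flux_tendsto_zero m (D_ne_zero x₂) (fun x hx => hp' x (Or.inr hx)) hpe₂
      fun k => ?_
    have h1 := tendsto_pi_nhds.1 hb k
    simp only [zero_smul, Pi.zero_apply] at h1
    refine h1.congr' ?_
    filter_upwards [self_mem_nhdsWithin] with x hx
    rw [D_mulVec_apply, D_right hx hx₂.1]
  have hdz : dz = 0 := by
    have h1 : -(dz • (Q m).col (0, 1)) = 0 := by
      refine tendsto_nhds_unique he (tendsto_const_nhds.congr' ?_)
      filter_upwards [Ioo_mem_nhdsLT hz] with x hx
      rw [right x hx, Matrix.mulVec_zero]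
    have h2 := congrFun h1 (1, 1)
    simpa [Q, windGen, comfortGen, hq0.ne'] using h2
  subst hdz
  exact ⟨fun x hx => hx.elim (left x) (right x), rfl⟩

theorem ae_mem_domain : ∀ᵐ x ∂(volume.restrict (Ioc 0 m.z)), x ∈ domain m := by
  have h1 : ∀ᵐ x ∂(volume.restrict (Ioc 0 m.z)), x ≠ m.Θ₁ := Measure.ae_ne _ _
  have h2 : ∀ᵐ x ∂(volume.restrict (Ioc 0 m.z)), x ≠ m.z := Measure.ae_ne _ _
  filter_upwards [h1, h2, ae_restrict_mem measurableSet_Ioc] with x h1 h2 h3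
  rcases lt_or_gt_of_ne h1 with h | h
  · exact Or.inl ⟨h3.1, h⟩
  · exact Or.inr ⟨h, lt_of_le_of_ne h3.2 h2⟩

theorem integral_congr_of_eqOn_domain {f g : ℝ → ℝ} (h : ∀ x ∈ domain m, f x = g x) :
    ∫ x in (0)..m.z, f x = ∫ x in (0)..m.z, g x := by
  have hz : 0 ≤ m.z := (m.Θ₁_pos.trans m.Θ₁_lt_z).le
  rw [intervalIntegral.integral_of_le hz, intervalIntegral.integral_of_le hz]
  refine integral_congr_ae ?_
  filter_upwards [ae_mem_domain] with x hx using h x hx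

theorem IsSolution.unique (hp : IsSolution m p δ) (hq : IsSolution m q ε) :
    (∀ x ∈ domain m, q x = p x) ∧ ε = δ := by
  have hpos : δ.zero₀ ≠ 0 := by
    intro h
    obtain ⟨h1, h2⟩ := hp.isFluxSolution.eq_zero_of_zero₀_eq_zero h
    have h3 := hp.normalization
    rw [integral_congr_of_eqOn_domain (g := fun _ => 0) (fun x hx => by simp [h1 x hx]), h2] at h3
    simp at h3
  -- this combination has no mass at temperature `0` in mode `10`, so it vanishes
  obtain ⟨h1, h2⟩ := (hq.isFluxSolution.linear_comb hp.isFluxSolution δ.zero₀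
    (-ε.zero₀)).eq_zero_of_zero₀_eq_zero (by ring)
  have h1' : ∀ x ∈ domain m, δ.zero₀ • q x = ε.zero₀ • p x := fun x hx => by
    have := h1 x hx
    rwa [neg_smul, ← sub_eq_add_neg, sub_eq_zero] at this
  simp only [Masses.mk.injEq] at h2
  obtain ⟨-, h4, h5, h6⟩ := h2
  have heq : δ.zero₀ = ε.zero₀ := by
    have hI : δ.zero₀ * ∫ x in (0)..m.z, ∑ k, q x k = ε.zero₀ * ∫ x in (0)..m.z, ∑ k, p x k := by
      rw [← intervalIntegral.integral_const_mul, ← intervalIntegral.integral_const_mul]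
      refine integral_congr_of_eqOn_domain fun x hx => ?_
      rw [Finset.mul_sum, Finset.mul_sum]
      exact Finset.sum_congr rfl fun k _ => by simpa using congrFun (h1' x hx) k
    have n1 := hp.normalization
    have n2 := hq.normalization
    linear_combination (-δ.zero₀) * n2 + ε.zero₀ * n1 + hI + h4 + h5 + h6
  rw [← heq] at h1' h4 h5 h6
  refine ⟨fun x hx => smul_right_injective _ hpos (h1' x hx), ?_⟩
  obtain ⟨a, b, c, d⟩ := δ
  obtain ⟨a', b', c', d'⟩ := ε
  simp only [Masses.mk.injEq] at *
  refine ⟨heq.symm, mul_left_cancel₀ hpos ?_, mul_left_cancel₀ hpos ?_,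
    mul_left_cancel₀ hpos ?_⟩ <;> linarith

end ZPolicy

namespace ZPolicy

/-! ### Pathwise properties of the temperature -/

variable {m : Params} {Ω : Type*} [MeasurableSpace Ω] {P : Measure Ω}
  {ℱ : Filtration ℝ≥0 (inferInstance : MeasurableSpace Ω)}
  {X : ℝ≥0 → Ω → ℝ} {J : ℝ≥0 → Ω → Mode}

theorem abs_velocity_le (x : ℝ) (k : Mode) : |velocity m x k| ≤ m.h + m.c := by
  have h1 := m.h_pos
  have h2 := m.c_pos
  unfold velocity
  split_ifs <;> simp [abs_of_pos, *] <;> linarith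

theorem velocity_nonneg_of_neg {x : ℝ} (hx : x < 0) (k : Mode) : 0 ≤ velocity m x k := by
  have h1 := m.h_pos
  have h2 : x < min m.z (limit m k.2) := by
    have h3 := m.Θ₁_pos
    have h4 := m.Θ₁_lt_z
    have h5 := m.z_le_Θ₂
    refine lt_min (by linarith) ?_
    unfold limit
    split_ifs <;> linarith
  unfold velocity
  rw [if_neg (not_lt.2 hx.le), if_pos h2]
  split_ifs <;> linarith

theorem velocity_nonpos_of_lt {x : ℝ} (hx : m.z < x) (k : Mode) : velocity m x k ≤ 0 := by
  have h1 := m.c_pos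
  unfold velocity
  rw [if_neg (not_lt.2 ((min_le_left _ _).trans hx.le))]
  split_ifs <;> linarith

theorem measurable_velocity (k : Mode) : Measurable fun x => velocity m x k := by
  unfold velocity
  split_ifs
  · exact Measurable.ite measurableSet_Ioi measurable_const measurable_const
  · exact Measurable.ite measurableSet_Iio measurable_const
      (Measurable.ite measurableSet_Ioi measurable_const measurable_const)

namespace IsProcess

variable (hproc : IsProcess m P ℱ X J)
include hproc

theorem continuous_path (ω : Ω) : Continuous fun s : ℝ => X s.toNNReal ω :=
  (hproc.continuous_temp ω).comp continuous_real_toNNReal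

theorem hasDerivWithinAt_path (ω : Ω) {t : ℝ} (ht : 0 ≤ t) :
    HasDerivWithinAt (fun s : ℝ => X s.toNNReal ω)
      (velocity m (X t.toNNReal ω) (J t.toNNReal ω)) (Ici t) t := by
  have := hproc.dynamics ω t.toNNReal
  rw [Real.coe_toNNReal t ht] at this
  exact this.Ici_of_Ioi

theorem abs_sub_le (ω : Ω) (t : ℝ≥0) : |X t ω - X 0 ω| ≤ (m.h + m.c) * t := by
  have := norm_image_sub_le_of_norm_deriv_right_le_segment (a := 0) (b := (t : ℝ))
    (hproc.continuous_path ω).continuousOn (fun s hs => hproc.hasDerivWithinAt_path ω hs.1)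
    (fun s _ => abs_velocity_le _ _) t ⟨t.2, le_rfl⟩
  simpa using this

/-- The temperature never leaves `[0, z]`: outside of this interval the velocity points back. -/
theorem mem_Icc (ω : Ω) (t : ℝ≥0) : X t ω ∈ Icc 0 m.z := by
  have h0 := hproc.init ω
  have hc := hproc.continuous_path ω
  -- the barrier moves at speed `ε`, which makes the comparison of the derivatives strict
  have key : ∀ ε > 0, -(ε * (t + 1)) ≤ X t ω ∧ X t ω ≤ m.z + ε * (t + 1) := by
    intro ε hε
    have hB : ∀ s : ℝ, HasDerivAt (fun s : ℝ => ε * (s + 1)) ε s := fun s => by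
      simpa using ((hasDerivAt_id s).add_const 1).const_mul ε
    have hpos : ∀ s ∈ Ico (0 : ℝ) t, 0 < ε * (s + 1) := fun s hs =>
      mul_pos hε (by linarith [hs.1])
    constructor
    · have := image_le_of_deriv_right_lt_deriv_boundary (a := 0) (b := (t : ℝ)) hc.neg.continuousOn
        (fun s hs => (hproc.hasDerivWithinAt_path ω hs.1).neg) (B := fun s => ε * (s + 1))
        (B' := fun _ => ε) (by simp; linarith [h0.1]) hB
        (fun s hs he => by
          have h1 := hpos s hs
          simp only [Pi.neg_apply] at he
          have h2 := velocity_nonneg_of_neg (m := m) (x := X s.toNNReal ω) (by linarith)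
            (J s.toNNReal ω)
          linarith) (x := (t : ℝ)) ⟨t.2, le_rfl⟩
      simp only [Pi.neg_apply, Real.toNNReal_coe] at this
      linarith
    · have := image_le_of_deriv_right_lt_deriv_boundary (a := 0) (b := (t : ℝ)) hc.continuousOn
        (fun s hs => hproc.hasDerivWithinAt_path ω hs.1) (B := fun s => m.z + ε * (s + 1))
        (B' := fun _ => ε) (by simp; linarith [h0.2]) (fun s => (hB s).const_add m.z)
        (fun s hs he => by
          have h1 := hpos s hs
          have h2 := velocity_nonpos_of_lt (m := m) (x := X s.toNNReal ω) (by linarith)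
            (J s.toNNReal ω)
          linarith) (x := (t : ℝ)) ⟨t.2, le_rfl⟩
      simpa using this
  have ht : (0 : ℝ) < t + 1 := by have := t.2; positivity
  constructor
  · refine le_of_forall_pos_lt_add fun ε hε => ?_
    have := (key (ε / 2 / (t + 1)) (by positivity)).1
    rw [div_mul_cancel₀ _ ht.ne'] at this
    linarith
  · refine le_of_forall_pos_lt_add fun ε hε => ?_
    have := (key (ε / 2 / (t + 1)) (by positivity)).2
    rw [div_mul_cancel₀ _ ht.ne'] at this
    linarith

theorem measurable_X (t : ℝ≥0) : Measurable (X t) := (hproc.measurable_temp t).mono (ℱ.le t) le_rfl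

theorem measurable_J (t : ℝ≥0) : Measurable (J t) := (hproc.measurable_mode t).mono (ℱ.le t) le_rfl

end IsProcess

/-! ### The stationarity equation in weak form -/

theorem hasDerivAt_exp_smul_matrix_apply {ι : Type*} [Fintype ι] [DecidableEq ι]
    (A : Matrix ι ι ℝ) (k l : ι) :
    HasDerivAt (fun s : ℝ => NormedSpace.exp (s • A) k l) (A k l) 0 := by
  let _ : NormedRing (Matrix ι ι ℝ) := Matrix.linftyOpNormedRing
  let _ : NormedAlgebra ℝ (Matrix ι ι ℝ) := Matrix.linftyOpNormedAlgebra
  have h := hasDerivAt_exp_smul_const (𝕂 := ℝ) A (0 : ℝ)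
  rw [zero_smul, NormedSpace.exp_zero, one_mul] at h
  let L : Matrix ι ι ℝ →L[ℝ] ℝ := (Matrix.entryLinearMap ℝ ℝ k l).toContinuousLinearMap
  exact L.hasFDerivAt.comp_hasDerivAt (0 : ℝ) h

/-- The law of the initial temperature on the event that the initial mode is `k`; its total mass is
the probability of this event. -/
noncomputable def modeLaw (P : Measure Ω) (X : ℝ≥0 → Ω → ℝ) (J : ℝ≥0 → Ω → Mode) (k : Mode) :
    Measure ℝ :=
  (P.restrict (J 0 ⁻¹' {k})).map (X 0)

instance [IsFiniteMeasure P] (k : Mode) : IsFiniteMeasure (modeLaw P X J k) := by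
  unfold modeLaw; infer_instance

namespace IsProcess

variable (hproc : IsProcess m P ℱ X J)
include hproc

theorem ae_modeLaw_mem_Icc (k : Mode) : ∀ᵐ x ∂modeLaw P X J k, x ∈ Icc 0 m.z := by
  exact (ae_map_iff (p := fun x => x ∈ Icc 0 m.z) (hproc.measurable_X 0).aemeasurable
    measurableSet_Icc).2 (ae_of_all _ hproc.init)

theorem integral_modeLaw {f : ℝ → ℝ} (hf : Measurable f) (k : Mode) :
    ∫ x, f x ∂modeLaw P X J k = ∫ ω, (J 0 ⁻¹' {k}).indicator (fun ω => f (X 0 ω)) ω ∂P := by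
  unfold modeLaw
  rw [integral_map (hproc.measurable_X 0).aemeasurable hf.aestronglyMeasurable,
    integral_indicator (hproc.measurable_J 0 (measurableSet_singleton k))]

theorem measurable_indicator (t : ℝ≥0) (k : Mode) :
    Measurable ({ω | J t ω = k}.indicator fun _ => (1 : ℝ)) :=
  measurable_const.indicator (hproc.measurable_J t (measurableSet_singleton k))

/-- The Markov property at time `0`, integrated against a function of the initial temperature. -/
theorem integral_mul_indicator [IsProbabilityMeasure P] {g : ℝ → ℝ} (hg : Measurable g) {C : ℝ}
    (hC : ∀ x ∈ Icc 0 m.z, |g x| ≤ C) (s : ℝ≥0) (k : Mode) :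
    ∫ ω, g (X 0 ω) * {ω | J s ω = k}.indicator (fun _ => (1 : ℝ)) ω ∂P =
      ∑ l, NormedSpace.exp ((s : ℝ) • Q m) k l * ∫ x, g x ∂modeLaw P X J l := by
  have hmk := hproc.markov 0 s k
  rw [zero_add] at hmk
  have hgm : StronglyMeasurable[ℱ 0] fun ω => g (X 0 ω) :=
    (hg.comp (hproc.measurable_temp 0)).stronglyMeasurable
  have hint : Integrable ({ω | J s ω = k}.indicator fun _ => (1 : ℝ)) P :=
    (integrable_const 1).indicator (hproc.measurable_J s (measurableSet_singleton k))
  have hb : ∀ ω, ‖g (X 0 ω)‖ ≤ C := fun ω => hC _ (hproc.init ω)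
  have hpull := condExp_stronglyMeasurable_mul_of_bound (ℱ.le 0) hgm hint C (ae_of_all P hb)
  have h1 := integral_condExp (μ := P) (f := (fun ω => g (X 0 ω)) *
    {ω | J s ω = k}.indicator fun _ => (1 : ℝ)) (ℱ.le 0)
  have hgi : Integrable (fun ω => g (X 0 ω)) P :=
    Integrable.of_bound (hg.comp (hproc.measurable_X 0)).aestronglyMeasurable C (ae_of_all P hb)
  calc _ = _ := h1.symm
    _ = ∫ ω, ∑ l, NormedSpace.exp ((s : ℝ) • Q m) k l *
          (J 0 ⁻¹' {l}).indicator (fun ω => g (X 0 ω)) ω ∂P := by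
      refine integral_congr_ae ?_
      filter_upwards [hpull, hmk] with ω h2 h3
      rw [h2, Pi.mul_apply, h3, Finset.sum_eq_single (J 0 ω)]
      · simp [mul_comm]
      · intro l _ hl
        rw [indicator_of_notMem (by simpa using hl.symm), mul_zero]
      · simp
    _ = _ := by
      rw [integral_finsetSum]
      · refine Finset.sum_congr rfl fun l _ => ?_
        rw [integral_const_mul, hproc.integral_modeLaw hg]
      · intro l _
        exact (hgi.indicator (hproc.measurable_J 0 (measurableSet_singleton l))).const_mul _

/-- The stationarity equation: the generator of the process, applied to the function
`(x, j) ↦ g x * 1_{j = k}`, has expectation zero under the stationary law. -/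
theorem integral_velocity_mul_deriv [IsProbabilityMeasure P] (hstat : IsStationary P X J)
    {g g' : ℝ → ℝ} (hg : ∀ x, HasDerivAt g (g' x) x) (hg' : Measurable g') {C : ℝ}
    (hC : ∀ x, |g' x| ≤ C) (k : Mode) :
    ∫ x, velocity m x k * g' x ∂modeLaw P X J k +
      ∑ l, Q m k l * ∫ x, g x ∂modeLaw P X J l = 0 := by
  have hgc : Continuous g := continuous_iff_continuousAt.2 fun x => (hg x).continuousAt
  have hlip : ∀ x y, |g y - g x| ≤ C * |y - x| := fun x y =>
    convex_univ.norm_image_sub_le_of_norm_hasDerivWithin_le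
      (fun x _ => (hg x).hasDerivWithinAt) (fun x _ => hC x) (mem_univ x) (mem_univ y)
  have hC0 : 0 ≤ C := (abs_nonneg _).trans (hC 0)
  obtain ⟨B, hB⟩ := (isCompact_Icc (a := (0 : ℝ)) (b := m.z)).exists_bound_of_continuousOn
    hgc.continuousOn
  let u : ℕ → ℝ≥0 := fun n => ((n : ℝ≥0) + 1)⁻¹
  have hu0 : ∀ n, 0 < u n := fun n => by positivity
  have hu : Tendsto u atTop (𝓝[>] 0) := by
    refine tendsto_nhdsWithin_iff.2 ⟨?_, Eventually.of_forall hu0⟩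
    simpa [u] using tendsto_one_div_add_atTop_nhds_zero_nat (𝕜 := ℝ≥0)
  have hu' : Tendsto (fun n => (u n : ℝ)) atTop (𝓝[>] 0) := by
    refine tendsto_nhdsWithin_iff.2 ⟨?_, Eventually.of_forall fun n => hu0 n⟩
    exact (NNReal.continuous_coe.tendsto 0).comp (tendsto_nhds_of_tendsto_nhdsWithin hu)
  have hXi : ∀ t, Integrable (fun ω => g (X t ω)) P := fun t =>
    Integrable.of_bound (hgc.measurable.comp (hproc.measurable_X t)).aestronglyMeasurable B
      (ae_of_all P fun ω => hB _ (hproc.mem_Icc ω t))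
  have hmul : ∀ t s, Integrable (fun ω => g (X t ω) *
      {ω | J s ω = k}.indicator (fun _ => (1 : ℝ)) ω) P := fun t s =>
    (hXi t).mul_bdd (c := 1) (hproc.measurable_indicator s k).aestronglyMeasurable
      (ae_of_all P fun ω => by
        by_cases h : J s ω = k <;> simp [indicator, h])
  -- stationarity, split into the increment of the temperature and that of the mode
  have hsplit : ∀ s : ℝ≥0,
      ∫ ω, (g (X s ω) - g (X 0 ω)) * {ω | J s ω = k}.indicator (fun _ => (1 : ℝ)) ω ∂P +
        ∑ l, (NormedSpace.exp ((s : ℝ) • Q m) k l - (1 : Matrix Mode Mode ℝ) k l) *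
          ∫ x, g x ∂modeLaw P X J l = 0 := by
    intro s
    have e1 : ∫ ω, g (X s ω) * {ω | J s ω = k}.indicator (fun _ => (1 : ℝ)) ω ∂P =
        ∫ ω, g (X 0 ω) * {ω | J 0 ω = k}.indicator (fun _ => (1 : ℝ)) ω ∂P := by
      have hm : Measurable fun y : ℝ × Mode =>
          g y.1 * {y : ℝ × Mode | y.2 = k}.indicator (fun _ => (1 : ℝ)) y :=
        (hgc.measurable.comp measurable_fst).mul
          (measurable_const.indicator (measurable_snd (measurableSet_singleton k)))
      have e2 : ∀ t, ∫ ω, g (X t ω) * {ω | J t ω = k}.indicator (fun _ => (1 : ℝ)) ω ∂P =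
          ∫ y, g y.1 * {y : ℝ × Mode | y.2 = k}.indicator (fun _ => (1 : ℝ)) y
            ∂(P.map fun ω => (X t ω, J t ω)) := fun t => by
        rw [integral_map ((hproc.measurable_X t).prodMk (hproc.measurable_J t)).aemeasurable
          hm.aestronglyMeasurable]
        rfl
      rw [e2, e2, hstat s]
    simp_rw [sub_mul]
    rw [integral_sub (hmul s s) (hmul 0 s), Finset.sum_sub_distrib, e1,
      ← hproc.integral_mul_indicator hgc.measurable hB s k,
      hproc.integral_mul_indicator hgc.measurable hB 0 k]
    simp [Matrix.one_apply]
  have lim1 : Tendsto (fun n => ∫ ω, (u n : ℝ)⁻¹ * ((g (X (u n) ω) - g (X 0 ω)) *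
      {ω | J (u n) ω = k}.indicator (fun _ => (1 : ℝ)) ω) ∂P) atTop
      (𝓝 (∫ x, velocity m x k * g' x ∂modeLaw P X J k)) := by
    rw [hproc.integral_modeLaw (f := fun x => velocity m x k * g' x)
      ((measurable_velocity k).mul hg')]
    refine tendsto_integral_of_dominated_convergence (fun _ => C * (m.h + m.c)) ?_
      (integrable_const _) ?_ ?_
    · intro n
      exact ((((hgc.measurable.comp (hproc.measurable_X _)).sub
        (hgc.measurable.comp (hproc.measurable_X _))).mul
        (hproc.measurable_indicator _ k)).const_mul _).aestronglyMeasurable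
    · intro n
      refine ae_of_all P fun ω => ?_
      have hun : (0 : ℝ) < u n := hu0 n
      have h1 : |g (X (u n) ω) - g (X 0 ω)| ≤ C * ((m.h + m.c) * u n) :=
        (hlip _ _).trans (mul_le_mul_of_nonneg_left (hproc.abs_sub_le ω _) hC0)
      have h2 : |{ω | J (u n) ω = k}.indicator (fun _ => (1 : ℝ)) ω| ≤ 1 := by
        by_cases h : J (u n) ω = k <;> simp [indicator, h]
      rw [Real.norm_eq_abs, abs_mul, abs_mul, abs_of_pos (inv_pos.2 hun), inv_mul_le_iff₀ hun]
      calc _ ≤ C * ((m.h + m.c) * u n) * 1 :=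
            mul_le_mul h1 h2 (abs_nonneg _) ((abs_nonneg _).trans h1)
        _ = _ := by ring
    · refine ae_of_all P fun ω => ?_
      have hJ : ∀ᶠ n in atTop, J (u n) ω = J 0 ω := hu.eventually (hproc.mode_right ω 0)
      have hd : HasDerivWithinAt (fun s : ℝ => g (X s.toNNReal ω))
          (g' (X 0 ω) * velocity m (X 0 ω) (J 0 ω)) (Ioi 0) 0 := by
        have h1 := hproc.dynamics ω 0
        rw [NNReal.coe_zero] at h1
        have h2 := (hg (X (0 : ℝ).toNNReal ω)).comp_hasDerivWithinAt (0 : ℝ) h1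
        simpa [Function.comp_def] using h2
      rw [hasDerivWithinAt_iff_tendsto_slope' (by simp)] at hd
      have hd' := hd.comp hu'
      by_cases hk : J 0 ω = k
      · rw [indicator_of_mem (by simpa using hk)]
        rw [hk, mul_comm] at hd'
        refine hd'.congr' ?_
        filter_upwards [hJ] with n hn
        simp [slope_def_field, indicator, hn, hk]
        ring
      · rw [indicator_of_notMem (by simpa using hk)]
        refine tendsto_const_nhds.congr' ?_
        filter_upwards [hJ] with n hn
        simp [indicator, hn, hk]
  have lim2 : Tendsto (fun n => ∑ l, (u n : ℝ)⁻¹ * ((NormedSpace.exp ((u n : ℝ) • Q m) k l -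
      (1 : Matrix Mode Mode ℝ) k l) * ∫ x, g x ∂modeLaw P X J l)) atTop
      (𝓝 (∑ l, Q m k l * ∫ x, g x ∂modeLaw P X J l)) := by
    refine tendsto_finsetSum _ fun l _ => ?_
    have h1 := (hasDerivAt_exp_smul_matrix_apply (Q m) k l).hasDerivWithinAt (s := Ioi 0)
    rw [hasDerivWithinAt_iff_tendsto_slope' (by simp)] at h1
    refine ((h1.comp hu').mul_const _).congr fun n => ?_
    simp [slope_def_field]
    ring
  refine tendsto_nhds_unique (lim1.add lim2) (tendsto_const_nhds.congr fun n => ?_)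
  rw [integral_const_mul, ← Finset.mul_sum, ← mul_add, hsplit, mul_zero]

end IsProcess

end ZPolicy

namespace ZPolicy

/-! ### Densities and point masses of an invariant law -/

/-- Equality of two finite signed measures with bounded densities can be tested on bounded
continuous functions. -/
theorem integral_mul_eq_of_forall_boundedContinuous {E : Type*} [MeasurableSpace E]
    [TopologicalSpace E] [HasOuterApproxClosed E] [BorelSpace E] {μ ν : Measure E}
    [IsFiniteMeasure μ] [IsFiniteMeasure ν] {a b : E → ℝ} (ha : Measurable a) (hb : Measurable b)
    {A B : ℝ} (hA : ∀ x, |a x| ≤ A) (hB : ∀ x, |b x| ≤ B)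
    (h : ∀ φ : BoundedContinuousFunction E ℝ, ∫ x, φ x * a x ∂μ = ∫ x, φ x * b x ∂ν)
    {φ : E → ℝ} (hφ : Measurable φ) {C : ℝ} (hC : ∀ x, |φ x| ≤ C) :
    ∫ x, φ x * a x ∂μ = ∫ x, φ x * b x ∂ν := by
  have hfin : ∀ {ρ : Measure E} [IsFiniteMeasure ρ] {f : E → ℝ} {K : ℝ}, Measurable f →
      (∀ x, |f x| ≤ K) → IsFiniteMeasure (ρ.withDensity fun x => ENNReal.ofReal (f x)) := by
    intro ρ _ f K hf hK
    exact isFiniteMeasure_withDensity_ofReal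
      (Integrable.of_bound hf.aestronglyMeasurable K (ae_of_all _ hK)).2
  have hwd : ∀ {ρ : Measure E} {f ψ : E → ℝ}, Measurable f →
      ∫ x, ψ x ∂(ρ.withDensity fun x => ENNReal.ofReal (f x)) = ∫ x, ψ x * max (f x) 0 ∂ρ := by
    intro ρ f ψ hf
    rw [integral_withDensity_eq_integral_toReal_smul hf.ennreal_ofReal
      (ae_of_all _ fun _ => ENNReal.ofReal_lt_top)]
    simp [ENNReal.toReal_ofReal', mul_comm]
  have hint : ∀ {ρ : Measure E} [IsFiniteMeasure ρ] {f ψ : E → ℝ} {K L : ℝ}, Measurable f →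
      (∀ x, |f x| ≤ K) → Measurable ψ → (∀ x, |ψ x| ≤ L) →
      Integrable (fun x => ψ x * max (f x) 0) ρ := by
    intro ρ _ f ψ K L hf hK hψ hL
    refine Integrable.of_bound (hψ.mul (hf.max measurable_const)).aestronglyMeasurable (L * K)
      (ae_of_all _ fun x => ?_)
    rw [Real.norm_eq_abs, abs_mul]
    have h1 : |max (f x) 0| ≤ K := by
      rw [abs_of_nonneg (le_max_right _ _)]
      exact max_le ((le_abs_self _).trans (hK x)) ((abs_nonneg _).trans (hK x))
    exact mul_le_mul (hL x) h1 (abs_nonneg _) ((abs_nonneg _).trans (hL x))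
  have hA' : ∀ x, |(-a) x| ≤ A := fun x => by simpa using hA x
  have hB' : ∀ x, |(-b) x| ≤ B := fun x => by simpa using hB x
  have := hfin (ρ := μ) ha hA
  have := hfin (ρ := μ) ha.neg hA'
  have := hfin (ρ := ν) hb hB
  have := hfin (ρ := ν) hb.neg hB'
  -- the signed identity says that these two finite positive measures coincide
  let M : Measure E := (μ.withDensity fun x => ENNReal.ofReal (a x)) +
    ν.withDensity fun x => ENNReal.ofReal ((-b) x)
  let N : Measure E := (μ.withDensity fun x => ENNReal.ofReal ((-a) x)) +
    ν.withDensity fun x => ENNReal.ofReal (b x)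
  have hint' : ∀ {ρ : Measure E} [IsFiniteMeasure ρ] {ψ : E → ℝ} {L : ℝ}, Measurable ψ →
      (∀ x, |ψ x| ≤ L) → Integrable ψ ρ := fun hψ hL =>
    Integrable.of_bound hψ.aestronglyMeasurable _ (ae_of_all _ hL)
  have key : ∀ {ψ : E → ℝ} {L : ℝ}, Measurable ψ → (∀ x, |ψ x| ≤ L) →
      ∫ x, ψ x ∂M - ∫ x, ψ x ∂N = ∫ x, ψ x * a x ∂μ - ∫ x, ψ x * b x ∂ν := by
    intro ψ L hψ hL
    rw [integral_add_measure (hint' hψ hL) (hint' hψ hL),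
      integral_add_measure (hint' hψ hL) (hint' hψ hL), hwd ha, hwd hb, hwd ha.neg, hwd hb.neg]
    have e1 : ∫ x, ψ x * a x ∂μ =
        ∫ x, ψ x * max (a x) 0 ∂μ - ∫ x, ψ x * max ((-a) x) 0 ∂μ := by
      rw [← integral_sub (hint ha hA hψ hL) (hint ha.neg hA' hψ hL)]
      refine integral_congr_ae (ae_of_all _ fun x => ?_)
      simp only [Pi.neg_apply, ← mul_sub]
      rw [max_zero_sub_max_neg_zero_eq_self]
    have e2 : ∫ x, ψ x * b x ∂ν =
        ∫ x, ψ x * max (b x) 0 ∂ν - ∫ x, ψ x * max ((-b) x) 0 ∂ν := by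
      rw [← integral_sub (hint hb hB hψ hL) (hint hb.neg hB' hψ hL)]
      refine integral_congr_ae (ae_of_all _ fun x => ?_)
      simp only [Pi.neg_apply, ← mul_sub]
      rw [max_zero_sub_max_neg_zero_eq_self]
    rw [e1, e2]
    ring
  have hMN : M = N := by
    refine ext_of_forall_integral_eq_of_IsFiniteMeasure fun φ => ?_
    have := key φ.continuous.measurable φ.norm_coe_le_norm
    rw [h φ, sub_self, sub_eq_zero] at this
    exact this
  have := key hφ hC
  rw [hMN, sub_self] at this
  exact (sub_eq_zero.1 this.symm)

variable (m : Params)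

/-- A family of measures, one for each mode, that is carried by `[0, z]` and annihilates the
generator of the process (temperature, mode) on smooth functions of the temperature in one mode. -/
structure IsInvariant (μ : Mode → Measure ℝ) : Prop where
  ae_mem : ∀ k, ∀ᵐ x ∂μ k, x ∈ Icc 0 m.z
  weak : ∀ (g g' : ℝ → ℝ) (C : ℝ), (∀ x, HasDerivAt g (g' x) x) → Measurable g' →
    (∀ x, |g' x| ≤ C) → ∀ k,
      ∫ x, velocity m x k * g' x ∂μ k + ∑ l, Q m k l * ∫ x, g x ∂μ l = 0

/-- The net rate of the mode changes into `k` at temperatures at most `y`. In equilibrium it is the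
flux of temperature through `y` in the mode `k`. -/
noncomputable def netRate (μ : Mode → Measure ℝ) (y : ℝ) (k : Mode) : ℝ :=
  ∑ l, Q m k l * (μ l).real (Iic y)

/-- The candidate for the density of `μ k`: the flux divided by the velocity, where the diagonal of
`D` stands for the velocity also at the temperatures `0`, `Θ₁` and `z`. -/
noncomputable def density (μ : Mode → Measure ℝ) (y : ℝ) (k : Mode) : ℝ :=
  netRate m μ y k / D m y k k

variable {m} {μ : Mode → Measure ℝ}

theorem D_mulVec_density (y : ℝ) : (D m y).mulVec (density m μ y) = netRate m μ y := by
  funext k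
  rw [D_mulVec_apply, density, mul_div_cancel₀ _ (D_ne_zero y k)]

theorem measurableSet_domain : MeasurableSet (domain m) := measurableSet_Ioo.union measurableSet_Ioo

theorem velocity_eq_D {x : ℝ} (hx : x ∈ domain m) (k : Mode) : velocity m x k = D m x k k := by
  rw [D_eq_velocity m hx, Matrix.diagonal_apply_eq]

theorem IsInvariant.measureReal_Iic_z (hμ : IsInvariant m μ) (l : Mode) :
    (μ l).real (Iic m.z) = (μ l).real univ := by
  refine measureReal_congr ?_
  filter_upwards [hμ.ae_mem l] with x hx
  exact propext ⟨fun _ => trivial, fun _ => hx.2⟩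

theorem IsInvariant.netRate_z (hμ : IsInvariant m μ) : netRate m μ m.z = 0 := by
  funext k
  have h := hμ.weak (fun _ => 1) (fun _ => 0) 0 (fun x => hasDerivAt_const x 1) measurable_const
    (by simp) k
  simp only [mul_zero, integral_zero, zero_add, integral_const, smul_eq_mul, mul_one] at h
  rw [Pi.zero_apply, ← h]
  exact Finset.sum_congr rfl fun l _ => by rw [hμ.measureReal_Iic_z]

variable [∀ k, IsFiniteMeasure (μ k)]

theorem monotone_real_Iic (l : Mode) : Monotone fun y => (μ l).real (Iic y) := fun _ _ h =>
  measureReal_mono (Iic_subset_Iic.2 h)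

theorem measurable_netRate (k : Mode) : Measurable fun y => netRate m μ y k :=
  Finset.measurable_fun_sum _ fun l _ => (monotone_real_Iic l).measurable.const_mul _

theorem abs_netRate_le (y : ℝ) (k : Mode) :
    |netRate m μ y k| ≤ ∑ l, |Q m k l| * (μ l).real univ := by
  refine (Finset.abs_sum_le_sum_abs _ _).trans (Finset.sum_le_sum fun l _ => ?_)
  rw [abs_mul, abs_of_nonneg (measureReal_nonneg (μ := μ l))]
  exact mul_le_mul_of_nonneg_left (measureReal_mono (subset_univ _)) (abs_nonneg _)

theorem measurable_inv_D (k : Mode) : Measurable fun y => (D m y k k)⁻¹ := by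
  simp only [D, Matrix.diagonal_apply_eq]
  refine Measurable.inv ?_
  split_ifs
  · exact Measurable.ite measurableSet_Iio measurable_const measurable_const
  all_goals exact measurable_const

theorem abs_inv_D_le (y : ℝ) (k : Mode) : |(D m y k k)⁻¹| ≤ m.h⁻¹ + m.c⁻¹ := by
  have h1 := inv_pos.2 m.h_pos
  have h2 := inv_pos.2 m.c_pos
  simp only [D, Matrix.diagonal_apply_eq]
  split_ifs <;> simp only [inv_neg, abs_neg, abs_of_pos h1, abs_of_pos h2] <;> linarith

theorem measurable_density (k : Mode) : Measurable fun y => density m μ y k := by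
  simp only [density, div_eq_mul_inv]
  exact (measurable_netRate k).mul (measurable_inv_D k)

theorem intervalIntegrable_density (k : Mode) (a b : ℝ) :
    IntervalIntegrable (fun y => density m μ y k) volume a b := by
  have hm := measurable_density (m := m) (μ := μ) k
  have hb : ∀ y, ‖density m μ y k‖ ≤
      (∑ l, |Q m k l| * (μ l).real univ) * (m.h⁻¹ + m.c⁻¹) := fun y => by
    rw [density, div_eq_mul_inv, Real.norm_eq_abs, abs_mul]
    exact mul_le_mul (abs_netRate_le y k) (abs_inv_D_le y k) (abs_nonneg _)
      ((abs_nonneg _).trans (abs_netRate_le y k))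
  exact ⟨Integrable.of_bound hm.aestronglyMeasurable _ (ae_of_all _ hb),
    Integrable.of_bound hm.aestronglyMeasurable _ (ae_of_all _ hb)⟩

theorem continuous_primitive_density :
    Continuous fun y => (Q m).mulVec (fun l => ∫ x in (0)..y, density m μ x l) := by
  refine Continuous.matrix_mulVec continuous_const (continuous_pi fun l => ?_)
  exact intervalIntegral.continuous_primitive (fun a b => intervalIntegrable_density l a b) 0

namespace IsInvariant

variable (hμ : IsInvariant m μ)
include hμ

/-- Fubini's theorem for a primitive that vanishes at `z`. -/
theorem integral_primitive (φ : BoundedContinuousFunction ℝ ℝ) (l : Mode) :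
    ∫ x, (∫ y in m.z..x, φ y) ∂μ l = -∫ y in Icc 0 m.z, φ y * (μ l).real (Iic y) := by
  have h1 : ∫ x, (∫ y in m.z..x, φ y) ∂μ l =
      -∫ x, (∫ y in Icc 0 m.z, (Iic y).indicator (fun _ => φ y) x) ∂μ l := by
    rw [← integral_neg]
    refine integral_congr_ae ?_
    filter_upwards [hμ.ae_mem l] with x hx
    rw [intervalIntegral.integral_symm, intervalIntegral.integral_of_le hx.2,
      ← integral_Icc_eq_integral_Ioc]
    have h2 : (fun y => (Iic y).indicator (fun _ => φ y) x) = (Ici x).indicator φ := by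
      funext y
      simp [indicator]
    rw [h2, setIntegral_indicator measurableSet_Ici]
    congr 3
    ext y
    simp only [mem_Icc, mem_inter_iff, mem_Ici]
    constructor
    · rintro ⟨h3, h4⟩; exact ⟨⟨hx.1.trans h3, h4⟩, h3⟩
    · rintro ⟨⟨-, h4⟩, h3⟩; exact ⟨h3, h4⟩
  rw [h1, integral_integral_swap]
  · congr 1
    refine integral_congr_ae (ae_of_all _ fun y => ?_)
    simp only
    rw [integral_indicator measurableSet_Iic, setIntegral_const, smul_eq_mul, mul_comm]
  · have hm : Measurable (Function.uncurry fun x y => (Iic y).indicator (fun _ => φ y) x) := by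
      have : (Function.uncurry fun x y => (Iic y).indicator (fun _ => φ y) x) =
          {w : ℝ × ℝ | w.1 ≤ w.2}.indicator fun w => φ w.2 := by
        funext w
        simp [Function.uncurry, indicator]
      rw [this]
      exact (φ.continuous.measurable.comp measurable_snd).indicator
        (measurableSet_le measurable_fst measurable_snd)
    refine Integrable.of_bound hm.aestronglyMeasurable ‖φ‖ (ae_of_all _ fun w => ?_)
    exact (norm_indicator_le_norm_self (fun _ => φ w.2) w.1).trans (φ.norm_coe_le_norm _)

/-- The signed measure with density `velocity · k` with respect to `μ k` has the density
`netRate · k` with respect to Lebesgue measure on `[0, z]`. -/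
theorem integral_mul_velocity {φ : ℝ → ℝ} (hφ : Measurable φ) {C : ℝ} (hC : ∀ x, |φ x| ≤ C)
    (k : Mode) :
    ∫ x, φ x * velocity m x k ∂μ k = ∫ y in Icc 0 m.z, φ y * netRate m μ y k := by
  refine integral_mul_eq_of_forall_boundedContinuous (measurable_velocity k) (measurable_netRate k)
    (fun x => abs_velocity_le x k) (fun y => abs_netRate_le y k) (fun φ => ?_) hφ hC
  have h1 := hμ.weak (fun x => ∫ y in m.z..x, φ y) φ ‖φ‖
    (fun x => intervalIntegral.integral_hasDerivAt_right (φ.continuous.intervalIntegrable _ _)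
      (φ.continuous.stronglyMeasurableAtFilter _ _) φ.continuous.continuousAt)
    φ.continuous.measurable φ.norm_coe_le_norm k
  simp_rw [hμ.integral_primitive φ] at h1
  have h2 : ∫ y in Icc 0 m.z, φ y * netRate m μ y k =
      ∑ l, Q m k l * ∫ y in Icc 0 m.z, φ y * (μ l).real (Iic y) := by
    simp_rw [← integral_const_mul]
    rw [← integral_finsetSum]
    · refine integral_congr_ae (ae_of_all _ fun y => ?_)
      simp only [netRate, Finset.mul_sum]
      exact Finset.sum_congr rfl fun l _ => by ring
    · intro l _
      refine Integrable.const_mul (Integrable.of_bound (C := ‖φ‖ * (μ l).real univ)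
        (φ.continuous.measurable.mul (monotone_real_Iic l).measurable).aestronglyMeasurable
        (ae_of_all _ fun y => ?_)) _
      rw [Pi.mul_apply, norm_mul, Real.norm_of_nonneg (measureReal_nonneg (μ := μ l))]
      exact mul_le_mul (φ.norm_coe_le_norm y) (measureReal_mono (subset_univ _)) measureReal_nonneg
        (norm_nonneg _)
  rw [h2]
  simp_rw [mul_comm (velocity m _ k), mul_neg, Finset.sum_neg_distrib] at h1
  linarith

/-- A mode has point masses only where its velocity vanishes. -/
theorem measureReal_singleton_eq_zero {x : ℝ} {k : Mode} (h : velocity m x k ≠ 0) :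
    (μ k).real {x} = 0 := by
  have h1 := hμ.integral_mul_velocity (φ := ({x} : Set ℝ).indicator fun _ => 1) (C := 1)
    (measurable_const.indicator (measurableSet_singleton x))
    (fun y => by by_cases hy : y ∈ ({x} : Set ℝ) <;> simp [indicator, hy]) k
  have h2 : ∫ y, ({x} : Set ℝ).indicator (fun _ => (1 : ℝ)) y * velocity m y k ∂μ k =
      (μ k).real {x} * velocity m x k := by
    have : (fun y => ({x} : Set ℝ).indicator (fun _ => (1 : ℝ)) y * velocity m y k) =
        ({x} : Set ℝ).indicator fun y => velocity m y k := by
      funext y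
      by_cases hy : y ∈ ({x} : Set ℝ) <;> simp [indicator, hy]
    rw [this, integral_indicator (measurableSet_singleton x), integral_singleton, smul_eq_mul]
  have h3 : ∫ y in Icc 0 m.z, ({x} : Set ℝ).indicator (fun _ => (1 : ℝ)) y * netRate m μ y k
      = 0 := by
    refine integral_eq_zero_of_ae ?_
    filter_upwards [Measure.ae_ne (volume.restrict (Icc 0 m.z)) x] with y hy
    simp [hy]
  rw [h2, h3] at h1
  exact (mul_eq_zero.1 h1).resolve_right h

theorem measureReal_eq_integral_density {S : Set ℝ} (hS : MeasurableSet S) (hSd : S ⊆ domain m)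
    (k : Mode) : (μ k).real S = ∫ y in S, density m μ y k := by
  have h1 := hμ.integral_mul_velocity (φ := S.indicator fun y => (D m y k k)⁻¹)
    (C := m.h⁻¹ + m.c⁻¹) ((measurable_inv_D k).indicator hS)
    (fun y => (norm_indicator_le_norm_self (fun y => (D m y k k)⁻¹) y).trans (abs_inv_D_le y k)) k
  have h2 : ∫ y, S.indicator (fun y => (D m y k k)⁻¹) y * velocity m y k ∂μ k = (μ k).real S := by
    have : (fun y => S.indicator (fun y => (D m y k k)⁻¹) y * velocity m y k) =
        S.indicator fun _ => 1 := by
      funext y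
      by_cases hy : y ∈ S
      · rw [indicator_of_mem hy, indicator_of_mem hy, velocity_eq_D (hSd hy),
          inv_mul_cancel₀ (D_ne_zero y k)]
      · simp [hy]
    rw [this, integral_indicator hS]
    simp
  have h3 : ∫ y in Icc 0 m.z, S.indicator (fun y => (D m y k k)⁻¹) y * netRate m μ y k =
      ∫ y in S, density m μ y k := by
    have hz := m.Θ₁_lt_z
    have h4 : Icc 0 m.z ∩ S = S := inter_eq_right.2 fun y hy => by
      have := m.Θ₁_pos
      rcases hSd hy with h | h
      · exact ⟨h.1.le, (h.2.trans hz).le⟩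
      · exact ⟨by linarith [h.1], h.2.le⟩
    have : (fun y => S.indicator (fun y => (D m y k k)⁻¹) y * netRate m μ y k) =
        S.indicator fun y => density m μ y k := by
      funext y
      by_cases hy : y ∈ S <;> simp [indicator, hy, density, div_eq_inv_mul]
    rw [this, setIntegral_indicator hS, h4]
  rw [← h2, h1, h3]

/-- The decomposition of `μ k` into a density and point masses. -/
theorem measureReal_eq {S : Set ℝ} (hS : MeasurableSet S) (k : Mode) :
    (μ k).real S = (μ k).real (S ∩ {0}) + (μ k).real (S ∩ {m.Θ₁}) + (μ k).real (S ∩ {m.z}) +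
      ∫ y in S ∩ domain m, density m μ y k := by
  have hΘ := m.Θ₁_pos
  have hz := m.Θ₁_lt_z
  have h1 : (μ k).real S = (μ k).real (S ∩ {0} ∪ S ∩ {m.Θ₁} ∪ S ∩ {m.z} ∪ S ∩ domain m) := by
    refine measureReal_congr ?_
    filter_upwards [hμ.ae_mem k] with x hx
    refine propext ⟨fun hxS => ?_, fun h => ?_⟩
    · rcases eq_or_ne x 0 with rfl | h0
      · exact Or.inl (Or.inl (Or.inl ⟨hxS, rfl⟩))
      rcases eq_or_ne x m.z with rfl | h1
      · exact Or.inl (Or.inr ⟨hxS, rfl⟩)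
      rcases lt_trichotomy x m.Θ₁ with h | rfl | h
      · exact Or.inr ⟨hxS, Or.inl ⟨lt_of_le_of_ne hx.1 h0.symm, h⟩⟩
      · exact Or.inl (Or.inl (Or.inr ⟨hxS, rfl⟩))
      · exact Or.inr ⟨hxS, Or.inr ⟨h, lt_of_le_of_ne hx.2 h1⟩⟩
    · rcases h with ((h | h) | h) | h <;> exact h.1
  have hs : ∀ a : ℝ, MeasurableSet (S ∩ {a}) := fun a => hS.inter (measurableSet_singleton a)
  rw [h1, measureReal_union _ (hS.inter measurableSet_domain), measureReal_union _ (hs _),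
    measureReal_union _ (hs _),
    hμ.measureReal_eq_integral_density (hS.inter measurableSet_domain) inter_subset_right]
  · rw [Set.disjoint_left]
    rintro x ⟨-, hx⟩ ⟨-, hx'⟩
    simp only [mem_singleton_iff] at hx hx'
    linarith
  · rw [Set.disjoint_left]
    rintro x (⟨-, hx⟩ | ⟨-, hx⟩) ⟨-, hx'⟩ <;>
    · simp only [mem_singleton_iff] at hx hx'
      linarith
  · rw [Set.disjoint_left]
    rintro x ((⟨-, hx⟩ | ⟨-, hx⟩) | ⟨-, hx⟩) ⟨-, hx' | hx'⟩ <;>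
    · simp only [mem_singleton_iff] at hx
      have h2 := hx'.1
      have h3 := hx'.2
      linarith

theorem measureReal_Iic_eq {y : ℝ} (hy : y ∈ Icc 0 m.z) (k : Mode) :
    (μ k).real (Iic y) = (μ k).real {0} + (if m.Θ₁ ≤ y then (μ k).real {m.Θ₁} else 0) +
      (if m.z ≤ y then (μ k).real {m.z} else 0) + ∫ x in (0)..y, density m μ x k := by
  have hs : ∀ a : ℝ, (μ k).real (Iic y ∩ {a}) = if a ≤ y then (μ k).real {a} else 0 := by
    intro a
    split_ifs with h
    · rw [inter_eq_right.2 (singleton_subset_iff.2 (mem_Iic.2 h))]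
    · rw [inter_singleton_eq_empty.2 (fun h' => h (mem_Iic.1 h')), measureReal_empty]
  rw [hμ.measureReal_eq measurableSet_Iic, hs, hs, hs, if_pos hy.1,
    intervalIntegral.integral_of_le hy.1]
  congr 1
  refine setIntegral_congr_set ?_
  filter_upwards [Measure.ae_ne volume m.Θ₁, Measure.ae_ne volume m.z] with x h1 h2
  refine propext ⟨fun h => ⟨?_, h.1⟩, fun h => ⟨h.2, ?_⟩⟩
  · have := m.Θ₁_pos
    rcases h.2 with h3 | h3
    · exact h3.1
    · exact this.trans h3.1
  · rcases lt_or_gt_of_ne h1 with h3 | h3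
    · exact Or.inl ⟨h.1, h3⟩
    · exact Or.inr ⟨h3, lt_of_le_of_ne (h.2.trans hy.2) h2⟩

/-- The net rate is a continuous function plus jumps at the point masses. -/
theorem netRate_eq {y : ℝ} (hy : y ∈ Icc 0 m.z) :
    netRate m μ y = (Q m).mulVec (fun l => (μ l).real {0}) +
      (if m.Θ₁ ≤ y then (Q m).mulVec (fun l => (μ l).real {m.Θ₁}) else 0) +
      (if m.z ≤ y then (Q m).mulVec (fun l => (μ l).real {m.z}) else 0) +
      (Q m).mulVec (fun l => ∫ x in (0)..y, density m μ x l) := by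
  have h : netRate m μ y = (Q m).mulVec fun l => (μ l).real (Iic y) := rfl
  rw [h]
  simp_rw [hμ.measureReal_Iic_eq hy]
  split_ifs <;> simp only [← Matrix.mulVec_add, add_zero] <;> rfl

end IsInvariant

end ZPolicy

namespace ZPolicy

variable {m : Params} {μ : Mode → Measure ℝ} [∀ k, IsFiniteMeasure (μ k)]

namespace IsInvariant

variable (hμ : IsInvariant m μ)
include hμ

/-- Away from `0`, `Θ₁` and `z` the distribution functions are locally primitives of the densities,
and the velocities are locally constant. -/
theorem eventually_measureReal_Iic_eq {y : ℝ} (hy : y ∈ domain m) :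
    ∃ c : Mode → ℝ, ∀ᶠ x in 𝓝 y, D m x = D m y ∧
      ∀ l, (μ l).real (Iic x) = c l + ∫ u in (0)..x, density m μ u l := by
  have hΘ := m.Θ₁_pos
  have hz := m.Θ₁_lt_z
  rcases hy with hy | hy
  · refine ⟨fun l => (μ l).real {0}, ?_⟩
    filter_upwards [Ioo_mem_nhds hy.1 hy.2] with x hx
    refine ⟨D_left hx.2 hy.2, fun l => ?_⟩
    rw [hμ.measureReal_Iic_eq ⟨hx.1.le, (hx.2.trans hz).le⟩, if_neg (not_le.2 hx.2),
      if_neg (not_le.2 (hx.2.trans hz)), add_zero, add_zero]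
  · refine ⟨fun l => (μ l).real {0} + (μ l).real {m.Θ₁}, ?_⟩
    filter_upwards [Ioo_mem_nhds hy.1 hy.2] with x hx
    refine ⟨D_right hx.1 hy.1, fun l => ?_⟩
    rw [hμ.measureReal_Iic_eq ⟨(hΘ.trans hx.1).le, hx.2.le⟩, if_pos hx.1.le,
      if_neg (not_le.2 hx.2), add_zero]

/-- The distribution function of `μ l` is differentiable. This is a bootstrap: it is continuous,
hence so is the density, which is a linear combination of distribution functions divided by the
locally constant velocity. -/
theorem hasDerivAt_measureReal_Iic {y : ℝ} (hy : y ∈ domain m) (l : Mode) :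
    HasDerivAt (fun x => (μ l).real (Iic x)) (density m μ y l) y := by
  obtain ⟨c, hc⟩ := hμ.eventually_measureReal_Iic_eq hy
  have hprim : ∀ l, Continuous fun x => ∫ u in (0)..x, density m μ u l := fun l =>
    intervalIntegral.continuous_primitive (fun a b => intervalIntegrable_density l a b) 0
  have hM : ∀ l, ContinuousAt (fun x => (μ l).real (Iic x)) y := fun l =>
    ((hprim l).const_add (c l)).continuousAt.congr (by
      filter_upwards [hc] with x hx using (hx.2 l).symm)
  have hN : ContinuousAt (fun x => netRate m μ x l) y :=
    tendsto_finsetSum _ fun k _ => (hM k).const_mul (Q m l k)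
  have hp : ContinuousAt (fun x => density m μ x l) y := by
    refine (hN.div_const (D m y l l)).congr ?_
    filter_upwards [hc] with x hx
    rw [density, hx.1]
  have hd := (intervalIntegral.integral_hasDerivAt_right (intervalIntegrable_density l 0 y)
    (measurable_density l).stronglyMeasurable.stronglyMeasurableAtFilter hp).const_add (c l)
  refine hd.congr_of_eventuallyEq ?_
  filter_upwards [hc] with x hx using hx.2 l

theorem density_nonneg {y : ℝ} (hy : y ∈ domain m) (k : Mode) : 0 ≤ density m μ y k :=
  (hμ.hasDerivAt_measureReal_Iic hy k).nonneg_of_monotone (monotone_real_Iic k)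

theorem hasDerivAt_density {y : ℝ} (hy : y ∈ domain m) :
    HasDerivAt (density m μ) (fun k => (Q m).mulVec (density m μ y) k / D m y k k) y := by
  obtain ⟨c, hc⟩ := hμ.eventually_measureReal_Iic_eq hy
  refine hasDerivAt_pi.2 fun k => ?_
  have hN : HasDerivAt (fun x => netRate m μ x k) ((Q m).mulVec (density m μ y) k) y :=
    HasDerivAt.fun_sum fun l _ => (hμ.hasDerivAt_measureReal_Iic hy l).const_mul (Q m k l)
  refine (hN.div_const _).congr_of_eventuallyEq ?_
  filter_upwards [hc] with x hx
  rw [density, hx.1]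

/-! ### The boundary conditions -/

theorem measureReal_zero_eq_zero (j : Fin 2) : (μ (0, j)).real {0} = 0 := by
  refine hμ.measureReal_singleton_eq_zero ?_
  have h1 := m.Θ₁_pos
  have h2 : 0 < m.z := h1.trans m.Θ₁_lt_z
  have h3 : 0 < m.Θ₂ := h2.trans_le m.z_le_Θ₂
  have h4 := m.h_pos.ne'
  fin_cases j <;> simp [velocity, limit, h1, h2, h3, h4]

theorem measureReal_Θ₁_eq_zero {k : Mode} (hk : k ≠ (0, 0)) : (μ k).real {m.Θ₁} = 0 := by
  refine hμ.measureReal_singleton_eq_zero ?_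
  have h1 := m.Θ₁_pos
  have h2 := m.Θ₁_lt_z
  have h3 : m.Θ₁ < m.Θ₂ := h2.trans_le m.z_le_Θ₂
  have h4 := m.h_pos.ne'
  have h5 := m.c_pos.ne'
  obtain ⟨i, j⟩ := k
  fin_cases i <;> fin_cases j <;> first
    | exact absurd rfl hk
    | simp [velocity, limit, h1, h2, h3, h4, h5]

theorem measureReal_z_eq_zero {k : Mode} (hk : k ≠ (0, 1)) : (μ k).real {m.z} = 0 := by
  refine hμ.measureReal_singleton_eq_zero ?_
  have h2 := m.Θ₁_lt_z
  have h1 : 0 < m.z := m.Θ₁_pos.trans h2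
  have h5 := m.c_pos.ne'
  obtain ⟨i, j⟩ := k
  fin_cases i <;> fin_cases j <;> first
    | exact absurd rfl hk
    | simp [velocity, limit, h1, h2, h2.le, not_lt.2 h2.le, h5]

theorem mulVec_masses_zero : (Q m).mulVec (fun l => (μ l).real {0}) =
    (μ (1, 0)).real {0} • (Q m).col (1, 0) + (μ (1, 1)).real {0} • (Q m).col (1, 1) := by
  funext k
  simp [Matrix.mulVec, dotProduct, Fintype.sum_prod_type, hμ.measureReal_zero_eq_zero, mul_comm]

theorem mulVec_masses_Θ₁ : (Q m).mulVec (fun l => (μ l).real {m.Θ₁}) =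
    (μ (0, 0)).real {m.Θ₁} • (Q m).col (0, 0) := by
  funext k
  simp [Matrix.mulVec, dotProduct, Fintype.sum_prod_type, hμ.measureReal_Θ₁_eq_zero, mul_comm]

theorem mulVec_masses_z : (Q m).mulVec (fun l => (μ l).real {m.z}) =
    (μ (0, 1)).real {m.z} • (Q m).col (0, 1) := by
  funext k
  simp [Matrix.mulVec, dotProduct, Fintype.sum_prod_type, hμ.measureReal_z_eq_zero, mul_comm]

omit hμ in
variable (m μ) in
/-- The point masses of the family `μ` at the temperatures where the velocity of a mode vanishes. -/
noncomputable def masses : Masses :=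
  ⟨(μ (1, 0)).real {0}, (μ (1, 1)).real {0}, (μ (0, 0)).real {m.Θ₁}, (μ (0, 1)).real {m.z}⟩

/-- The flux is `netRate μ`, whose jumps come from the point masses only; this gives the boundary
conditions. -/
theorem isSolution (hmass : ∑ k, (μ k).real univ = 1) :
    IsSolution m (density m μ) (masses m μ) := by
  have hΘ := m.Θ₁_pos
  have hz := m.Θ₁_lt_z
  have hG := continuous_primitive_density (m := m) (μ := μ)
  have hleft : ∀ {y}, y ∈ Ico 0 m.Θ₁ → netRate m μ y =
      (Q m).mulVec (fun l => (μ l).real {0}) +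
        (Q m).mulVec (fun l => ∫ x in (0)..y, density m μ x l) := fun {y} hy => by
    rw [hμ.netRate_eq ⟨hy.1, (hy.2.trans hz).le⟩, if_neg (not_le.2 hy.2),
      if_neg (not_le.2 (hy.2.trans hz)), add_zero, add_zero]
  have hright : ∀ {y}, y ∈ Ico m.Θ₁ m.z → netRate m μ y =
      (Q m).mulVec (fun l => (μ l).real {0}) + (Q m).mulVec (fun l => (μ l).real {m.Θ₁}) +
        (Q m).mulVec (fun l => ∫ x in (0)..y, density m μ x l) := fun {y} hy => by
    rw [hμ.netRate_eq ⟨hΘ.le.trans hy.1, hy.2.le⟩, if_pos hy.1,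
      if_neg (not_le.2 hy.2), add_zero]
  have hlim : ∀ {l : Filter ℝ} {y : ℝ} (v : Mode → ℝ), l ≤ 𝓝 y →
      (∀ᶠ x in l, netRate m μ x =
        v + (Q m).mulVec (fun l => ∫ u in (0)..x, density m μ u l)) →
      Tendsto (netRate m μ) l
        (𝓝 (v + (Q m).mulVec (fun l => ∫ u in (0)..y, density m μ u l))) := by
    intro l y v hl he
    refine (((hG.tendsto y).mono_left hl).const_add v).congr' ?_
    filter_upwards [he] with x hx using hx.symm
  refine ⟨fun x hx => ⟨_, hμ.hasDerivAt_density hx, ?_⟩, ?_, ?_, ?_,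
    fun k => intervalIntegrable_density k _ _, ?_⟩
  · funext k
    rw [D_mulVec_apply, mul_div_cancel₀ _ (D_ne_zero x k)]
  · simp only [D_mulVec_density]
    refine ⟨_, _, hlim (y := m.Θ₁) ((Q m).mulVec fun l => (μ l).real {0}) nhdsWithin_le_nhds
        (by filter_upwards [Ioo_mem_nhdsLT hΘ] with x hx using hleft ⟨hx.1.le, hx.2⟩),
      hlim (y := m.Θ₁) ((Q m).mulVec (fun l => (μ l).real {0}) +
          (Q m).mulVec fun l => (μ l).real {m.Θ₁}) nhdsWithin_le_nhds
        (by filter_upwards [Ioo_mem_nhdsGT hz] with x hx using hright ⟨hx.1.le, hx.2⟩), ?_⟩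
    rw [hμ.mulVec_masses_Θ₁, masses]
    abel
  · simp only [D_mulVec_density]
    refine ⟨_, hlim (y := m.z) ((Q m).mulVec (fun l => (μ l).real {0}) +
          (Q m).mulVec fun l => (μ l).real {m.Θ₁}) nhdsWithin_le_nhds
        (by filter_upwards [Ioo_mem_nhdsLT hz] with x hx using hright ⟨hx.1.le, hx.2⟩), ?_⟩
    have h := hμ.netRate_z
    rw [hμ.netRate_eq ⟨(hΘ.trans hz).le, le_rfl⟩, if_pos hz.le, if_pos le_rfl,
      hμ.mulVec_masses_z] at h
    rw [masses, eq_neg_iff_add_eq_zero, ← h]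
    abel
  · simp only [D_mulVec_density]
    refine ⟨_, hlim (y := 0) ((Q m).mulVec fun l => (μ l).real {0}) nhdsWithin_le_nhds
        (by filter_upwards [Ioo_mem_nhdsGT hΘ] with x hx using hleft ⟨hx.1.le, hx.2⟩), ?_⟩
    simp only [intervalIntegral.integral_same]
    rw [hμ.mulVec_masses_zero, masses]
    simp [← Pi.zero_def]
  · have h : ∀ k, (μ k).real univ = (μ k).real {0} + (μ k).real {m.Θ₁} + (μ k).real {m.z} +
        ∫ x in (0)..m.z, density m μ x k := fun k => by
      rw [← hμ.measureReal_Iic_z, hμ.measureReal_Iic_eq ⟨(hΘ.trans hz).le, le_rfl⟩,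
        if_pos hz.le, if_pos le_rfl]
    rw [intervalIntegral.integral_finsetSum fun k _ => intervalIntegrable_density k _ _]
    simp only [h, Fintype.sum_prod_type, Fin.sum_univ_two, hμ.measureReal_zero_eq_zero] at hmass
    simp [hμ.measureReal_Θ₁_eq_zero, hμ.measureReal_z_eq_zero] at hmass
    simp only [masses, Fintype.sum_prod_type, Fin.sum_univ_two]
    linarith

/-! ### Reconstruction of the law -/

theorem eq_withDensity_add (k : Mode) : μ k =
    ((volume.restrict (Ioo 0 m.z)).withDensity fun x => ENNReal.ofReal (density m μ x k)) +
      ENNReal.ofReal ((μ k).real {0}) • Measure.dirac 0 +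
      ENNReal.ofReal ((μ k).real {m.Θ₁}) • Measure.dirac m.Θ₁ +
      ENNReal.ofReal ((μ k).real {m.z}) • Measure.dirac m.z := by
  ext S hS
  have hatom : ∀ a : ℝ, ENNReal.ofReal ((μ k).real {a}) * (Measure.dirac a) S =
      ENNReal.ofReal ((μ k).real (S ∩ {a})) := by
    intro a
    rw [Measure.dirac_apply' _ hS]
    by_cases ha : a ∈ S
    · rw [inter_eq_right.2 (singleton_subset_iff.2 ha)]
      simp [ha]
    · rw [inter_singleton_eq_empty.2 ha]
      simp [ha]
  have hae : (Ioo 0 m.z ∩ S : Set ℝ) =ᵐ[volume] (S ∩ domain m : Set ℝ) := by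
    filter_upwards [Measure.ae_ne volume m.Θ₁] with x h1
    have hΘ := m.Θ₁_pos
    have hz := m.Θ₁_lt_z
    refine propext ⟨fun h => ⟨h.2, ?_⟩, fun h => ⟨?_, h.1⟩⟩
    · rcases lt_or_gt_of_ne h1 with h3 | h3
      · exact Or.inl ⟨h.1.1, h3⟩
      · exact Or.inr ⟨h3, h.1.2⟩
    · rcases h.2 with h3 | h3
      · exact ⟨h3.1, h3.2.trans hz⟩
      · exact ⟨hΘ.trans h3.1, h3.2⟩
  have hsub : S ∩ domain m ⊆ Ioc 0 m.z := fun x hx => by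
    have hΘ := m.Θ₁_pos
    have hz := m.Θ₁_lt_z
    rcases hx.2 with h3 | h3
    · exact ⟨h3.1, (h3.2.trans hz).le⟩
    · exact ⟨hΘ.trans h3.1, h3.2.le⟩
  have hdens : ((volume.restrict (Ioo 0 m.z)).withDensity
      fun x => ENNReal.ofReal (density m μ x k)) S =
      ENNReal.ofReal (∫ x in S ∩ domain m, density m μ x k) := by
    rw [withDensity_apply _ hS, Measure.restrict_restrict hS, inter_comm S,
      Measure.restrict_congr_set hae, ofReal_integral_eq_lintegral_ofReal]
    · exact (intervalIntegrable_density k 0 m.z).1.mono_set hsub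
    · filter_upwards [ae_restrict_mem (hS.inter measurableSet_domain)] with x hx
      exact hμ.density_nonneg hx.2 k
  have hnn : 0 ≤ ∫ x in S ∩ domain m, density m μ x k :=
    setIntegral_nonneg (hS.inter measurableSet_domain) fun x hx => hμ.density_nonneg hx.2 k
  simp only [Measure.add_apply, Measure.smul_apply, smul_eq_mul]
  rw [hatom, hatom, hatom, hdens, ← ofReal_measureReal (μ := μ k), hμ.measureReal_eq hS,
    ENNReal.ofReal_add (by positivity) hnn, ENNReal.ofReal_add (by positivity) (by positivity),
    ENNReal.ofReal_add (by positivity) (by positivity)]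
  ring

theorem sum_map_eq_law : ∑ k, (μ k).map (fun x => (x, k)) = law m (density m μ) (masses m μ) := by
  have hk : ∀ k, (μ k).map (fun x => (x, k)) =
      ((volume.restrict (Ioo 0 m.z)).withDensity
        fun x => ENNReal.ofReal (density m μ x k)).map (fun x => (x, k)) +
      ENNReal.ofReal ((μ k).real {0}) • Measure.dirac (0, k) +
      ENNReal.ofReal ((μ k).real {m.Θ₁}) • Measure.dirac (m.Θ₁, k) +
      ENNReal.ofReal ((μ k).real {m.z}) • Measure.dirac (m.z, k) := fun k => by
    have hm : Measurable fun x : ℝ => (x, k) := measurable_prodMk_right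
    conv_lhs => rw [hμ.eq_withDensity_add k]
    rw [Measure.map_add _ _ hm, Measure.map_add _ _ hm, Measure.map_add _ _ hm, Measure.map_smul,
      Measure.map_smul, Measure.map_smul, Measure.map_dirac' hm, Measure.map_dirac' hm,
      Measure.map_dirac' hm]
  simp_rw [hk, Finset.sum_add_distrib]
  have h0 : ∑ k : Mode, ENNReal.ofReal ((μ k).real {0}) • Measure.dirac ((0 : ℝ), k) =
      ENNReal.ofReal ((μ (1, 0)).real {0}) • Measure.dirac (0, (1, 0)) +
        ENNReal.ofReal ((μ (1, 1)).real {0}) • Measure.dirac (0, (1, 1)) := by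
    simp only [Fintype.sum_prod_type, Fin.sum_univ_two, hμ.measureReal_zero_eq_zero,
      ENNReal.ofReal_zero, zero_smul, zero_add]
  have hΘ : ∑ k : Mode, ENNReal.ofReal ((μ k).real {m.Θ₁}) • Measure.dirac (m.Θ₁, k) =
      ENNReal.ofReal ((μ (0, 0)).real {m.Θ₁}) • Measure.dirac (m.Θ₁, (0, 0)) := by
    simp only [Fintype.sum_prod_type, Fin.sum_univ_two, ENNReal.ofReal_zero, zero_smul,
      add_zero, hμ.measureReal_Θ₁_eq_zero (k := (0, 1)) (by decide),
      hμ.measureReal_Θ₁_eq_zero (k := (1, 0)) (by decide),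
      hμ.measureReal_Θ₁_eq_zero (k := (1, 1)) (by decide)]
  have hz : ∑ k : Mode, ENNReal.ofReal ((μ k).real {m.z}) • Measure.dirac (m.z, k) =
      ENNReal.ofReal ((μ (0, 1)).real {m.z}) • Measure.dirac (m.z, (0, 1)) := by
    simp only [Fintype.sum_prod_type, Fin.sum_univ_two, ENNReal.ofReal_zero, zero_smul, zero_add,
      add_zero, hμ.measureReal_z_eq_zero (k := (0, 0)) (by decide),
      hμ.measureReal_z_eq_zero (k := (1, 0)) (by decide),
      hμ.measureReal_z_eq_zero (k := (1, 1)) (by decide)]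
  rw [h0, hΘ, hz, law, masses]
  simp only [add_assoc]

end IsInvariant

variable {Ω : Type*} [MeasurableSpace Ω] {P : Measure Ω}
  {ℱ : Filtration ℝ≥0 (inferInstance : MeasurableSpace Ω)}
  {X : ℝ≥0 → Ω → ℝ} {J : ℝ≥0 → Ω → Mode}

namespace IsProcess

variable (hproc : IsProcess m P ℱ X J)
include hproc

theorem isInvariant_modeLaw [IsProbabilityMeasure P] (hstat : IsStationary P X J) :
    IsInvariant m (modeLaw P X J) where
  ae_mem := hproc.ae_modeLaw_mem_Icc
  weak _ _ _ hg hg' hC k := hproc.integral_velocity_mul_deriv hstat hg hg' hC k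

theorem sum_map_modeLaw :
    ∑ k, (modeLaw P X J k).map (fun x => (x, k)) = P.map fun ω => (X 0 ω, J 0 ω) := by
  have hJ := hproc.measurable_J 0
  have hX := hproc.measurable_X 0
  ext S hS
  have hT : MeasurableSet ((fun ω => (X 0 ω, J 0 ω)) ⁻¹' S) := (hX.prodMk hJ) hS
  rw [Measure.map_apply (hX.prodMk hJ) hS, Measure.finsetSum_apply]
  have hk : ∀ k, ((modeLaw P X J k).map fun x => (x, k)) S =
      P (((fun ω => (X 0 ω, J 0 ω)) ⁻¹' S) ∩ J 0 ⁻¹' {k}) := fun k => by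
    have hm : Measurable fun x : ℝ => (x, k) := measurable_prodMk_right
    rw [modeLaw, Measure.map_map hm hX, Measure.map_apply (hm.comp hX) hS,
      Measure.restrict_apply ((hm.comp hX) hS)]
    congr 1
    ext ω
    simp only [mem_inter_iff, mem_preimage, Function.comp_apply, mem_singleton_iff]
    refine and_congr_left fun h => ?_
    rw [h]
  simp_rw [hk]
  rw [← measure_biUnion_finset]
  · congr 1
    ext ω
    simp
  · intro k _ l _ hkl
    rw [Function.onFun, Set.disjoint_left]
    rintro ω ⟨-, h1⟩ ⟨-, h2⟩
    exact hkl (h1.symm.trans h2)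
  · exact fun k _ => hT.inter (hJ (measurableSet_singleton k))

theorem sum_measureReal_modeLaw [IsProbabilityMeasure P] :
    ∑ k, (modeLaw P X J k).real univ = 1 := by
  have h1 := congrArg (fun ρ : Measure (ℝ × Mode) => ρ univ) hproc.sum_map_modeLaw
  have hm : ∀ k : Mode, Measurable fun x : ℝ => (x, k) := fun k => measurable_prodMk_right
  simp only [Measure.finsetSum_apply, Measure.map_apply (hm _) MeasurableSet.univ,
    Measure.map_apply ((hproc.measurable_X 0).prodMk (hproc.measurable_J 0)) MeasurableSet.univ,
    preimage_univ, measure_univ] at h1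
  simp only [Measure.real]
  rw [← ENNReal.toReal_sum fun k _ => measure_ne_top _ _, h1, ENNReal.toReal_one]

end IsProcess

end ZPolicy

theorem mainTheorem4 (m : ZPolicy.Params)
    {Ω : Type*} [MeasurableSpace Ω] (P : Measure Ω) [IsProbabilityMeasure P]
    (ℱ : Filtration ℝ≥0 (inferInstance : MeasurableSpace Ω))
    (X : ℝ≥0 → Ω → ℝ) (J : ℝ≥0 → Ω → ZPolicy.Mode)
    (hproc : ZPolicy.IsProcess m P ℱ X J) (hstat : ZPolicy.IsStationary P X J) :
    ∃ (p : ℝ → ZPolicy.Mode → ℝ) (δ : ZPolicy.Masses),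
      (∀ x ∈ ZPolicy.domain m, ∀ k, 0 ≤ p x k) ∧
      (0 ≤ δ.zero₀ ∧ 0 ≤ δ.zero₁ ∧ 0 ≤ δ.atΘ₁ ∧ 0 ≤ δ.atz) ∧
      (∀ t, P.map (fun ω => (X t ω, J t ω)) = ZPolicy.law m p δ) ∧
      ZPolicy.IsSolution m p δ ∧
      (∀ (p' : ℝ → ZPolicy.Mode → ℝ) (δ' : ZPolicy.Masses), ZPolicy.IsSolution m p' δ' →
        (∀ x ∈ ZPolicy.domain m, p' x = p x) ∧ δ' = δ) := by
  have hμ := hproc.isInvariant_modeLaw hstat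
  have hsol := hμ.isSolution hproc.sum_measureReal_modeLaw
  refine ⟨_, _, fun x hx k => hμ.density_nonneg hx k,
    ⟨measureReal_nonneg, measureReal_nonneg, measureReal_nonneg, measureReal_nonneg⟩,
    fun t => ?_, hsol, fun p' δ' h => hsol.unique h⟩
  rw [hstat t, ← hproc.sum_map_modeLaw, hμ.sum_map_eq_law]
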